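/- Let $M$ be a smooth manifold of dimension $n$ and let $K_1,\dots,K_n$ be smooth operator fields (that is, $(1,1)$-tensor fields) on $M$. For operator fields $L$, $N$ with $LN=NL$ let $$\langle L,N\rangle(\xi,\eta)=N[L\xi,\eta]+L[\xi,N\eta]-[L\xi,N\eta]-LN[\xi,\eta]$$ for vector fields $\xi,\eta$. Assume that $K_1,\dots,K_n$ are mutual symmetries: for all $i,j$ we have $K_iK_j=K_jK_i$ on $M$, and $\langle K_i,K_j\rangle(\xi,\xi)=0$ for all smooth vector fields $\xi$ (on open subsets of $M$). Let $p\in M$ be a point at which $K_1(p),\dots,K_n(p)$ are linearly independent endomorphisms of $T_pM$, and such that for some constants $c_1,\dots,c_n\in\mathbb{R}$ the endomorphism $\sum_i c_iK_i(p)$ has $n$ distinct real eigenvalues. Then there exists a smooth local coordinate system on an open neighbourhood of $p$ (``Riemann invariants'') in which, at every point of this neighbourhood, every $K_i$ is given by a diagonal matrix. -/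

import Mathlib

open scoped Manifold ContDiff

noncomputable section

/-- A smooth operator field, that is, a smooth `(1,1)`-tensor field, on a smooth manifold `M` of
dimension `n`: a smooth section of the bundle of endomorphisms of the tangent spaces. -/
abbrev OperatorField (n : ℕ) (M : Type*) [TopologicalSpace M]
    [ChartedSpace (EuclideanSpace ℝ (Fin n)) M] [IsManifold (𝓡 n) ∞ M] : Type _ :=
  ContMDiffSection (𝓡 n) (EuclideanSpace ℝ (Fin n) →L[ℝ] EuclideanSpace ℝ (Fin n)) ∞
    (fun x : M => TangentSpace (𝓡 n) x →L[ℝ] TangentSpace (𝓡 n) x)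

namespace OperatorField

variable {n : ℕ} {M : Type*} [TopologicalSpace M]
  [ChartedSpace (EuclideanSpace ℝ (Fin n)) M] [IsManifold (𝓡 n) ∞ M]

/-- `ξ` is a smooth vector field on the set `U`. -/
def SmoothVectorFieldOn (ξ : Π x : M, TangentSpace (𝓡 n) x) (U : Set M) : Prop :=
  ContMDiffOn (𝓡 n) (𝓡 n).tangent ∞ (fun x => (⟨x, ξ x⟩ : TangentBundle (𝓡 n) M)) U

/-- The Nijenhuis concomitant
`⟨A, B⟩(ξ, η) = B [A ξ, η] + A [ξ, B η] - [A ξ, B η] - A B [ξ, η]`,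
where the brackets on the right are Lie brackets of vector fields. -/
def concomitant (A B : OperatorField n M) (ξ η : Π x : M, TangentSpace (𝓡 n) x) (x : M) :
    TangentSpace (𝓡 n) x :=
  B x (VectorField.mlieBracket (𝓡 n) (fun y => A y (ξ y)) η x)
    + A x (VectorField.mlieBracket (𝓡 n) ξ (fun y => B y (η y)) x)
    - VectorField.mlieBracket (𝓡 n) (fun y => A y (ξ y)) (fun y => B y (η y)) x
    - A x (B x (VectorField.mlieBracket (𝓡 n) ξ η x))

/-- `B` is a symmetry of `A`: the two operator fields commute, and `⟨A, B⟩(ξ, ξ) = 0` for all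
smooth vector fields `ξ` (given on any open subset of the manifold). -/
def IsSymmetry (A B : OperatorField n M) : Prop :=
  (∀ x, (A x).comp (B x) = (B x).comp (A x)) ∧
    ∀ (U : Set M) (ξ : Π x : M, TangentSpace (𝓡 n) x), IsOpen U → SmoothVectorFieldOn ξ U →
      ∀ x ∈ U, concomitant A B ξ ξ x = 0

/-- The coordinate vector field `∂ / ∂ φ_b` of the local coordinates `φ`, at a point `x` of their
domain. -/
def coordVector (φ : OpenPartialHomeomorph M (EuclideanSpace ℝ (Fin n))) (b : Fin n) (x : M) :
    TangentSpace (𝓡 n) x :=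
  (mfderiv (𝓡 n) (𝓡 n) φ x).inverse (EuclideanSpace.single b (1 : ℝ))

/-- The matrix of the operator field `A` at the point `x` in the local coordinates `φ`: its
`b`-th column is made of the `φ`-coordinates of `A (∂ / ∂ φ_b)` at `x`. -/
def coordMatrix (A : OperatorField n M)
    (φ : OpenPartialHomeomorph M (EuclideanSpace ℝ (Fin n))) (x : M) :
    Matrix (Fin n) (Fin n) ℝ :=
  Matrix.of fun a b =>
    (show EuclideanSpace ℝ (Fin n) from
      mfderiv (𝓡 n) (𝓡 n) φ x
        (A x (coordVector φ b x))) a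

end OperatorField

end

/-! The simple eigencovectors of `L = ∑ cᵢ Kᵢ` at `p` extend to smooth eigencovector fields `θ_a` of
`L`, which form a coframe near `p`. Every `Kᵢ` commutes with `L`, so `θ_a ∘ Kᵢ = Λᵢₐ θ_a`, and
linear independence of the `Kᵢ(p)` forces `det Λ ≠ 0` (`exists_contDiffOn_eigencovector`). It
remains to rescale each `θ_a` to a differential `du_a`; the `u_a` are then the Riemann invariants.
By Frobenius this requires `dθ_a = 0` on `ker θ_a`.

Let `θ` be a common eigencovector field of `A`, `B` with eigenvalues `α`, `β`. Applying `θ` to `⟨A,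
B⟩(ξ, ξ) = 0` for `ξ` in `ker θ` gives `dθ((α - A)ξ, (β - B)ξ) = 0` (`fderiv_eigencovector_comm`).
If `ξ` in `ker θ_a` has all other coframe components equal to `1`, the vectors `(Λᵢₐ - Kᵢ)ξ` span
`ker θ_a` because `det Λ ≠ 0`, so bilinearity yields integrability
(`bilinear_comm_on_ker_of_diagonal`).

Frobenius' theorem (`exists_fderiv_eq_smul`) comes from sweeping out the leaves by curves tangent to
`ker θ` that start on a transversal line. Smooth dependence on parameters is obtained by solving the
integral equation of these curves with the implicit function theorem on `C([0,1])`. -/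

open scoped Manifold ContDiff Topology

noncomputable section

/-! ### Inverse and implicit function theorems on neighbourhoods. -/

section InverseFunction

variable {E F : Type*} [NormedAddCommGroup E] [NormedSpace ℝ E] [CompleteSpace E]
  [NormedAddCommGroup F] [NormedSpace ℝ F]

/-- The smooth inverse function theorem, on a whole neighbourhood of the point. -/
theorem exists_openPartialHomeomorph_contDiffOn_symm {f : E → F} {U : Set E} (hU : IsOpen U)
    (hf : ContDiffOn ℝ ∞ f U) {a : E} (ha : a ∈ U) (hinv : (fderiv ℝ f a).IsInvertible) :
    ∃ Φ : OpenPartialHomeomorph E F, a ∈ Φ.source ∧ Φ.source ⊆ U ∧ (∀ x, Φ x = f x) ∧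
      (∀ x ∈ Φ.source, (fderiv ℝ f x).IsInvertible) ∧ ContDiffOn ℝ ∞ Φ.symm Φ.target := by
  have hfa : ContDiffAt ℝ ∞ f a := hf.contDiffAt (hU.mem_nhds ha)
  obtain ⟨f', hf'⟩ := hinv
  have hd : HasFDerivAt f (f' : E →L[ℝ] F) a := by
    rw [hf']; exact (hfa.differentiableAt (by simp)).hasFDerivAt
  have hcont : ContinuousOn (fderiv ℝ f) U := hf.continuousOn_fderiv_of_isOpen hU (by simp)
  -- Invertible operators form an open set, so after shrinking the source the derivative is
  -- invertible, and the inverse smooth, at every point and not only at `a`.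
  have hopen : IsOpen (U ∩ fderiv ℝ f ⁻¹' Set.range ((↑) : (E ≃L[ℝ] F) → E →L[ℝ] F)) :=
    hcont.isOpen_inter_preimage hU ContinuousLinearEquiv.isOpen
  let Φ := (hfa.toOpenPartialHomeomorph f hd (by simp)).restrOpen _ hopen
  have hsrc : ∀ x ∈ Φ.source, x ∈ U ∧ fderiv ℝ f x ∈
      Set.range ((↑) : (E ≃L[ℝ] F) → E →L[ℝ] F) := fun x hx => hx.2
  refine ⟨Φ, ⟨hfa.mem_toOpenPartialHomeomorph_source hd (by simp), ha, f', hf'⟩,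
    fun x hx => (hsrc x hx).1, fun x => rfl, fun x hx => (hsrc x hx).2, ?_⟩
  intro y hy
  have hx := Φ.map_target hy
  obtain ⟨g', hg'⟩ := (hsrc _ hx).2
  have hfx : ContDiffAt ℝ ∞ f (Φ.symm y) := hf.contDiffAt (hU.mem_nhds (hsrc _ hx).1)
  refine (Φ.contDiffAt_symm hy (f₀' := g') ?_ hfx).contDiffWithinAt
  rw [hg']
  exact (hfx.differentiableAt (by simp)).hasFDerivAt

/-- The smooth implicit function theorem, on a whole neighbourhood of the point. -/
theorem exists_contDiffOn_implicitFunction {P X Y : Type*} [NormedAddCommGroup P] [NormedSpace ℝ P]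
    [CompleteSpace P] [NormedAddCommGroup X] [NormedSpace ℝ X] [CompleteSpace X]
    [NormedAddCommGroup Y] [NormedSpace ℝ Y] {G : P × X → Y} {U : Set (P × X)} (hU : IsOpen U)
    (hG : ContDiffOn ℝ ∞ G U) {p : P} {x : X} (hpx : (p, x) ∈ U) (h0 : G (p, x) = 0)
    (e : X ≃L[ℝ] Y) (he : ∀ v, fderiv ℝ G (p, x) (0, v) = e v) :
    ∃ W : Set P, IsOpen W ∧ p ∈ W ∧ ∃ g : P → X, ContDiffOn ℝ ∞ g W ∧ g p = x ∧
      ∀ q ∈ W, (q, g q) ∈ U ∧ G (q, g q) = 0 ∧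
        ∀ v, fderiv ℝ G (q, g q) (0, v) = 0 → v = 0 := by
  -- Invertibility of `DH` on the whole source also gives injectivity of the partial derivative of
  -- `G` at all nearby solutions.
  let H : P × X → P × Y := fun q => (q.1, G q)
  have hH : ContDiffOn ℝ ∞ H U := contDiff_fst.contDiffOn.prodMk hG
  have hdH : ∀ q ∈ U, fderiv ℝ H q = (ContinuousLinearMap.fst ℝ P X).prod (fderiv ℝ G q) := by
    intro q hq
    have hGq : DifferentiableAt ℝ G q :=
      (hG.contDiffAt (hU.mem_nhds hq)).differentiableAt (by simp)
    exact (hasFDerivAt_fst.prodMk hGq.hasFDerivAt).fderiv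
  have hinv : (fderiv ℝ H (p, x)).IsInvertible := by
    rw [hdH _ hpx]
    let D : P →L[ℝ] Y := (fderiv ℝ G (p, x)).comp (ContinuousLinearMap.inl ℝ P X)
    have hD : ∀ a v, fderiv ℝ G (p, x) (a, v) = D a + e v := by
      intro a v
      rw [← he v]
      simp only [D, ContinuousLinearMap.comp_apply, ContinuousLinearMap.inl_apply]
      rw [← map_add]; simp
    refine ⟨ContinuousLinearEquiv.equivOfInverse ((ContinuousLinearMap.fst ℝ P X).prod
      (fderiv ℝ G (p, x))) ((ContinuousLinearMap.fst ℝ P Y).prod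
      ((e.symm : Y →L[ℝ] X).comp (ContinuousLinearMap.snd ℝ P Y -
        D.comp (ContinuousLinearMap.fst ℝ P Y)))) ?_ ?_, rfl⟩
    · rintro ⟨a, v⟩
      simp [hD]
    · rintro ⟨a, v⟩
      simp [hD]
  obtain ⟨Φ, hmem, hsub, hΦ, hΦinv, hsymm⟩ :=
    exists_openPartialHomeomorph_contDiffOn_symm hU hH hpx hinv
  have hq : ∀ q, (q, (0 : Y)) ∈ Φ.target →
      (q, (Φ.symm (q, 0)).2) = Φ.symm (q, 0) ∧ G (Φ.symm (q, 0)) = 0 := by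
    intro q hq
    have h1 := Φ.right_inv hq
    rw [hΦ] at h1
    exact ⟨Prod.ext (congrArg Prod.fst h1).symm rfl, congrArg Prod.snd h1⟩
  have hΦp : Φ (p, x) = (p, 0) := by rw [hΦ]; exact Prod.ext rfl h0
  refine ⟨(fun q => (q, (0 : Y))) ⁻¹' Φ.target, Φ.open_target.preimage (by fun_prop), ?_,
    fun q => (Φ.symm (q, 0)).2, ?_, ?_, ?_⟩
  · change (p, (0 : Y)) ∈ Φ.target
    rw [← hΦp]; exact Φ.map_source hmem
  · exact contDiff_snd.comp_contDiffOn
      (hsymm.comp (contDiff_prodMk_left (0 : Y)).contDiffOn fun q hq => hq)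
  · simp only [← hΦp, Φ.left_inv hmem]
  · intro q hqt
    have hs := Φ.map_target hqt
    rw [(hq q hqt).1]
    refine ⟨hsub hs, (hq q hqt).2, fun v hv => ?_⟩
    obtain ⟨f', hf'⟩ := hΦinv _ hs
    rw [hdH _ (hsub hs)] at hf'
    have : f' (0, v) = 0 := by
      change (f' : P × X →L[ℝ] P × Y) (0, v) = 0
      rw [hf']
      exact Prod.ext rfl hv
    have := (map_eq_zero_iff f' f'.injective).1 this
    exact congrArg Prod.snd this

end InverseFunction

/-! ### Smoothness of superposition operators on spaces of continuous maps. -/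

namespace ContinuousMap

open Classical in
/-- Superposition `γ ↦ g ∘ γ` on continuous maps, with value `0` when `g ∘ γ` is not continuous. -/
def superposition {X E F : Type*} [TopologicalSpace X] [TopologicalSpace E] [TopologicalSpace F]
    [Zero F] (g : E → F) (γ : C(X, E)) : C(X, F) :=
  if h : Continuous (g ∘ γ) then ⟨g ∘ γ, h⟩ else 0

theorem superposition_apply {X E F : Type*} [TopologicalSpace X] [TopologicalSpace E]
    [TopologicalSpace F] [Zero F] {g : E → F} {U : Set E} (hg : ContinuousOn g U) {γ : C(X, E)}
    (hγ : ∀ x, γ x ∈ U) (x : X) : superposition g γ x = g (γ x) := by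
  have h : Continuous (g ∘ γ) := hg.comp_continuous γ.continuous hγ
  simp [superposition, h]

variable {X : Type*} [TopologicalSpace X] [CompactSpace X]

theorem isOpen_setOf_forall_mem {E : Type*} [NormedAddCommGroup E] {U : Set E} (hU : IsOpen U) :
    IsOpen {γ : C(X, E) | ∀ x, γ x ∈ U} := by
  simpa [Set.MapsTo] using ContinuousMap.isOpen_setOfPred_mapsTo (isCompact_univ (X := X)) hU

/-- The range of `γ` is compact, so a single `δ` controls `g` near all of its points. -/
theorem continuousOn_superposition {E F : Type*} [NormedAddCommGroup E] [NormedAddCommGroup F]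
    {g : E → F} {U : Set E} (hU : IsOpen U)
    (hg : ContinuousOn g U) :
    ContinuousOn (superposition (X := X) g) {γ | ∀ x, γ x ∈ U} := by
  intro γ hγ
  rw [Metric.continuousWithinAt_iff]
  intro ε hε
  have hK : IsCompact (Set.range γ) := isCompact_range γ.continuous
  have := hK.uniformContinuousAt_of_continuousAt g
    (by rintro _ ⟨x, rfl⟩; exact hg.continuousAt (hU.mem_nhds (hγ x)))
    (Metric.dist_mem_uniformity (half_pos hε))
  obtain ⟨δ, hδ, h⟩ := Metric.mem_uniformity_dist.1 this
  refine ⟨δ, hδ, fun {γ'} hγ' hd => ?_⟩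
  refine lt_of_le_of_lt ((ContinuousMap.dist_le (half_pos hε).le).2 fun x => ?_) (half_lt_self hε)
  rw [superposition_apply hg hγ, superposition_apply hg hγ', dist_comm]
  have h1 : dist (γ x) (γ' x) < δ := by
    rw [dist_comm]; exact (ContinuousMap.dist_apply_le_dist x).trans_lt hd
  exact (h h1 ⟨x, rfl⟩).le

section

variable {E F : Type*} [NormedAddCommGroup E] [NormedSpace ℝ E]
  [NormedAddCommGroup F] [NormedSpace ℝ F]

variable (X E F) in
/-- The pointwise application of a continuous family of continuous linear maps. -/
def pointwiseApply : C(X, E →L[ℝ] F) →L[ℝ] C(X, E) →L[ℝ] C(X, F) :=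
  LinearMap.mkContinuous₂
    (LinearMap.mk₂ ℝ (fun (T : C(X, E →L[ℝ] F)) (h : C(X, E)) =>
      (⟨fun x => T x (h x), T.continuous.clm_apply h.continuous⟩ : C(X, F)))
      (fun _ _ _ => by ext; simp) (fun _ _ _ => by ext; simp)
      (fun _ _ _ => by ext; simp) (fun _ _ _ => by ext; simp)) 1
    (fun T h => by
      rw [one_mul]
      refine (ContinuousMap.norm_le _ (by positivity)).2 fun x => ?_
      exact ((T x).le_opNorm (h x)).trans
        (by gcongr; exacts [T.norm_coe_le_norm x, h.norm_coe_le_norm x]))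

@[simp]
theorem pointwiseApply_apply (T : C(X, E →L[ℝ] F)) (h : C(X, E)) (x : X) :
    pointwiseApply X E F T h x = T x (h x) := rfl

/-- The mean value inequality, applied to `g` minus its linear part at `γ x`, gives an error at most
`ε ‖γ' - γ‖`. It is uniform in `x` because superposition with `fderiv ℝ g` is continuous at `γ`. -/
theorem hasFDerivAt_superposition {g : E → F} {U : Set E} (hU : IsOpen U)
    (hg : ContDiffOn ℝ 1 g U) {γ : C(X, E)} (hγ : ∀ x, γ x ∈ U) :
    HasFDerivAt (superposition (X := X) g)
      (pointwiseApply X E F (superposition (fderiv ℝ g) γ)) γ := by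
  have hg' : ContinuousOn (fderiv ℝ g) U := hg.continuousOn_fderiv_of_isOpen hU le_rfl
  have hS := isOpen_setOf_forall_mem (X := X) hU
  have hc := (continuousOn_superposition (X := X) hU hg').continuousAt (hS.mem_nhds hγ)
  rw [hasFDerivAt_iff_isLittleO, Asymptotics.isLittleO_iff]
  intro ε hε
  obtain ⟨δ, hδ, h⟩ := Metric.eventually_nhds_iff_ball.1
    ((Metric.tendsto_nhds.1 hc ε hε).and (hS.mem_nhds hγ))
  filter_upwards [Metric.ball_mem_nhds γ hδ] with γ' hγ'
  refine (ContinuousMap.norm_le _ (by positivity)).2 fun x => ?_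
  have hseg : ∀ y ∈ segment ℝ (γ x) (γ' x), y ∈ U ∧ ‖fderiv ℝ g y - fderiv ℝ g (γ x)‖ ≤ ε := by
    rintro y ⟨a, b, ha, hb, hab, rfl⟩
    -- Convexity of the ball in the function space keeps every pointwise segment inside `U`.
    have hmem : a • γ + b • γ' ∈ Metric.ball γ δ :=
      (convex_ball γ δ) (Metric.mem_ball_self hδ) hγ' ha hb hab
    obtain ⟨h1, h2⟩ := h _ hmem
    refine ⟨by simpa using h2 x, ?_⟩
    have h3 := (ContinuousMap.dist_apply_le_dist x).trans h1.le
    rw [superposition_apply hg' h2, superposition_apply hg' hγ, dist_eq_norm] at h3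
    simpa using h3
  have hmv := (convex_segment (γ x) (γ' x)).norm_image_sub_le_of_norm_hasFDerivWithin_le
    (f := fun y => g y - fderiv ℝ g (γ x) y) (f' := fun y => fderiv ℝ g y - fderiv ℝ g (γ x))
    (C := ε) (fun y hy => by
      have := ((hg.contDiffAt (hU.mem_nhds (hseg y hy).1)).differentiableAt one_ne_zero).hasFDerivAt
      exact (this.sub (fderiv ℝ g (γ x)).hasFDerivAt).hasFDerivWithinAt)
    (fun y hy => (hseg y hy).2) (left_mem_segment ℝ _ _) (right_mem_segment ℝ _ _)
  have hx1 : ‖γ' x - γ x‖ ≤ ‖γ' - γ‖ := (γ' - γ).norm_coe_le_norm x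
  have hγ'U := (h γ' hγ').2
  simp only [ContinuousMap.sub_apply, pointwiseApply_apply]
  rw [superposition_apply hg.continuousOn hγ, superposition_apply hg.continuousOn hγ'U,
    superposition_apply hg' hγ]
  refine le_trans (le_of_eq ?_) (hmv.trans (by gcongr))
  congr 1
  rw [map_sub]; abel

end

/-- The derivative is again a superposition, by `fderiv ℝ g`, followed by a continuous linear map;
hence induction on the order. The target `F` must vary in the induction, as it becomes `E →L[ℝ] F`.
-/
theorem contDiffOn_superposition {E F : Type} [NormedAddCommGroup E] [NormedSpace ℝ E]
    [NormedAddCommGroup F] [NormedSpace ℝ F] {g : E → F} {U : Set E} (hU : IsOpen U)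
    (hg : ContDiffOn ℝ ∞ g U) :
    ContDiffOn ℝ ∞ (superposition (X := X) g) {γ | ∀ x, γ x ∈ U} := by
  have hS := isOpen_setOf_forall_mem (X := X) hU
  suffices H : ∀ (n : ℕ) (F : Type) [NormedAddCommGroup F] [NormedSpace ℝ F] (g : E → F),
      ContDiffOn ℝ ∞ g U → ContDiffOn ℝ n (superposition (X := X) g) {γ | ∀ x, γ x ∈ U} from
    contDiffOn_infty.2 fun n => H n F g hg
  clear hg g
  intro n
  induction n with
  | zero =>
    intro F _ _ g hg
    exact contDiffOn_zero.2 (continuousOn_superposition hU hg.continuousOn)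
  | succ n ih =>
    intro F _ _ g hg
    have hd := fun γ hγ => hasFDerivAt_superposition (X := X) hU (hg.of_le (by simp)) (γ := γ) hγ
    rw [Nat.cast_succ, contDiffOn_succ_iff_fderiv_of_isOpen hS]
    refine ⟨fun γ hγ => (hd γ hγ).differentiableAt.differentiableWithinAt, by simp, ?_⟩
    have hg' : ContDiffOn ℝ ∞ (fderiv ℝ g) U := hg.fderiv_of_isOpen hU (by simp)
    have h := (pointwiseApply X E F).contDiff.comp_contDiffOn (n := (n : ℕ∞ω)) (ih _ _ hg')
    exact h.congr fun γ hγ => (hd γ hγ).fderiv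

end ContinuousMap

/-! ### Frobenius: variations of curves tangent to the kernel. -/

section Frobenius

variable {E : Type*} [NormedAddCommGroup E] [NormedSpace ℝ E]

/-- Propagation along integral curves of `ker θ`: a variation `ρ` of the integral curves, starting
at `0`, stays in `ker θ` if `dθ` vanishes on `ker θ`. -/
theorem apply_variation_eq_zero {U : Set E} (hU : IsOpen U) {θ : E → E →L[ℝ] ℝ}
    (hθ : ContDiffOn ℝ ∞ θ U) {e : E} (he : ∀ y ∈ U, θ y e = 1)
    (hint : ∀ y ∈ U, ∀ v w, θ y v = 0 → θ y w = 0 → fderiv ℝ θ y v w = fderiv ℝ θ y w v)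
    {y₀ x v : E} {z ζ : ℝ → ℝ} {Γ : ℝ → E} (hΓ : ∀ t, Γ t = y₀ + t • x + z t • e)
    (hΓU : ∀ t ∈ Set.Icc (0 : ℝ) 1, Γ t ∈ U)
    (hz : ∀ t ∈ Set.Icc (0 : ℝ) 1, HasDerivAt z (-θ (Γ t) x) t)
    (hζ : ∀ t ∈ Set.Icc (0 : ℝ) 1, HasDerivAt ζ
      (-(θ (Γ t) v + fderiv ℝ θ (Γ t) (t • v + ζ t • e) x)) t)
    (hζ0 : ζ 0 = 0) : θ (Γ 1) (v + ζ 1 • e) = 0 := by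
  have hθd : ∀ y ∈ U, HasFDerivAt θ (fderiv ℝ θ y) y := fun y hy =>
    ((hθ.contDiffAt (hU.mem_nhds hy)).differentiableAt (by simp)).hasFDerivAt
  -- Differentiate `θ(e) = 1`.
  have hDe : ∀ y ∈ U, ∀ b, fderiv ℝ θ y b e = 0 := by
    intro y hy b
    have h1 : HasFDerivAt (fun y => θ y e) ((fderiv ℝ θ y).flip e) y := by
      simpa using! (hθd y hy).clm_apply (hasFDerivAt_const e y)
    have h2 : HasFDerivAt (fun y => θ y e) (0 : E →L[ℝ] ℝ) y :=
      (hasFDerivAt_const (1 : ℝ) y).congr_of_eventuallyEq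
        (by filter_upwards [hU.mem_nhds hy] with y' hy' using he y' hy')
    simpa using congrArg (fun T : E →L[ℝ] ℝ => T b) (h1.unique h2)
  set τ : ℝ → E := fun t => x - θ (Γ t) x • e with hτ
  set ρ : ℝ → E := fun t => t • v + ζ t • e with hρ
  set Y : ℝ → ℝ := fun t => θ (Γ t) (ρ t) with hY
  have hΓd : ∀ t ∈ Set.Icc (0 : ℝ) 1, HasDerivAt Γ (τ t) t := by
    intro t ht
    have h1 := (((hasDerivAt_id t).smul_const x).const_add y₀).add ((hz t ht).smul_const e)
    have h2 : Γ = fun t => y₀ + id t • x + z t • e := funext hΓ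
    rw [h2]
    refine h1.congr_deriv ?_
    simp only [hτ, neg_smul, one_smul, sub_eq_add_neg]
  have hYd : ∀ t ∈ Set.Icc (0 : ℝ) 1, HasDerivAt Y (-(fderiv ℝ θ (Γ t) e (τ t)) * Y t) t := by
    intro t ht
    have hρd : HasDerivAt ρ (v + (-(θ (Γ t) v + fderiv ℝ θ (Γ t) (ρ t) x)) • e) t := by
      exact (((hasDerivAt_id t).smul_const v).add ((hζ t ht).smul_const e)).congr_deriv
        (by rw [one_smul])
    have hy := hΓU t ht
    have h1 := ((hθd _ hy).comp_hasDerivAt t (hΓd t ht)).clm_apply hρd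
    refine h1.congr_deriv ?_
    -- Both vectors lie in `ker θ`. The correction `Y e` turns the equation for `Y` into a
    -- homogeneous linear one, so Gronwall with initial value `0` gives `Y = 0`.
    have h2 := hint _ hy (τ t) (ρ t - Y t • e) (by simp [hτ, he _ hy]) (by simp [hY, he _ hy])
    have h3 : fderiv ℝ θ (Γ t) (ρ t) (τ t) = fderiv ℝ θ (Γ t) (ρ t) x := by
      simp [hτ, hDe _ hy]
    simp only [map_sub, map_smul, hDe _ hy, sub_apply,
      smul_apply, smul_eq_mul, mul_zero, sub_zero, h3] at h2
    simp only [Function.comp_apply, map_add, map_smul, he _ hy, smul_eq_mul, mul_one]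
    rw [h2]; ring
  have hΓc : ContinuousOn Γ (Set.Icc 0 1) := fun t ht =>
    (hΓd t ht).continuousAt.continuousWithinAt
  have hθc : ContinuousOn (fun t => θ (Γ t)) (Set.Icc 0 1) :=
    hθ.continuousOn.comp hΓc hΓU
  have hDc : ContinuousOn (fun t => fderiv ℝ θ (Γ t)) (Set.Icc 0 1) :=
    (hθ.continuousOn_fderiv_of_isOpen hU (by simp)).comp hΓc hΓU
  have hac : ContinuousOn (fun t => fderiv ℝ θ (Γ t) e (τ t)) (Set.Icc 0 1) := by
    refine (hDc.clm_apply continuousOn_const).clm_apply ?_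
    exact continuousOn_const.sub ((hθc.clm_apply continuousOn_const).smul continuousOn_const)
  obtain ⟨K, hK⟩ := isCompact_Icc.exists_bound_of_continuousOn hac
  have hg := norm_le_gronwallBound_of_norm_deriv_right_le (f := Y) (δ := 0) (K := K) (ε := 0)
    (fun t ht => (hYd t ht).continuousAt.continuousWithinAt)
    (fun t ht => (hYd t ⟨ht.1, ht.2.le⟩).hasDerivWithinAt) (by simp [hY, hρ, hζ0])
    (fun t ht => by
      rw [norm_mul, norm_neg, add_zero]
      exact mul_le_mul_of_nonneg_right (hK t ⟨ht.1, ht.2.le⟩) (norm_nonneg _)) 1 (by simp)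
  have hY1 : Y 1 = 0 := by
    have hb : gronwallBound 0 K 0 (1 - 0) = 0 := by
      rw [gronwallBound_ε0]; simp
    exact norm_le_zero_iff.1 (hg.trans hb.le)
  simpa [hY, hρ] using hY1

end Frobenius

/-! ### Integration and curves as bounded operators on `C([0,1])`. -/

section Primitive

open unitInterval MeasureTheory

/-- Integration from `0` as an operator on continuous functions on the unit interval. -/
def unitInterval.primitive : C(I, ℝ) →L[ℝ] C(I, ℝ) :=
  LinearMap.mkContinuous
    { toFun := fun f => ⟨fun t => ∫ s in (0 : ℝ)..t, f (Set.projIcc 0 1 zero_le_one s),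
        (intervalIntegral.continuous_primitive (fun a b => Continuous.intervalIntegrable
          (f.continuous.comp continuous_projIcc) a b) 0).comp continuous_subtype_val⟩
      map_add' := fun f g => by
        ext t
        exact intervalIntegral.integral_add
          (Continuous.intervalIntegrable (f.continuous.comp continuous_projIcc) _ _)
          (Continuous.intervalIntegrable (g.continuous.comp continuous_projIcc) _ _)
      map_smul' := fun c f => by
        ext t
        exact intervalIntegral.integral_const_mul c _ } 1 (fun f => by
    rw [one_mul]
    refine (ContinuousMap.norm_le _ (norm_nonneg f)).2 fun t => ?_
    refine (intervalIntegral.norm_integral_le_of_norm_le_const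
      (fun s _ => f.norm_coe_le_norm (Set.projIcc 0 1 zero_le_one s))).trans ?_
    rw [sub_zero, abs_of_nonneg t.2.1]
    exact mul_le_of_le_one_right (norm_nonneg f) t.2.2)

theorem unitInterval.primitive_apply (f : C(I, ℝ)) (t : I) :
    unitInterval.primitive f t = ∫ s in (0 : ℝ)..t, f (Set.projIcc 0 1 zero_le_one s) := rfl

/-- Extending `f` by its end values gives a continuous integrand on `ℝ`, so the derivative is
two-sided even at `0` and `1`. -/
theorem unitInterval.hasDerivAt_integral_projIcc (f : C(I, ℝ)) (t : ℝ) :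
    HasDerivAt (fun t : ℝ => ∫ s in (0 : ℝ)..t, f (Set.projIcc 0 1 zero_le_one s))
      (f (Set.projIcc 0 1 zero_le_one t)) t := by
  have hc : Continuous fun s : ℝ => f (Set.projIcc 0 1 zero_le_one s) :=
    f.continuous.comp continuous_projIcc
  exact intervalIntegral.integral_hasDerivAt_right (hc.intervalIntegrable _ _)
    (hc.stronglyMeasurableAtFilter _ _) hc.continuousAt

end Primitive

section Paths

open unitInterval

variable {E : Type*} [NormedAddCommGroup E] [NormedSpace ℝ E]

/-- The pair of the constant map `x` and the curve `t ↦ t x + z(t) e`. -/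
def curvePair (e : E) : E × C(I, ℝ) →L[ℝ] C(I, E × E) :=
  LinearMap.mkContinuous
    { toFun := fun q => ⟨fun t => (q.1, (t : ℝ) • q.1 + q.2 t • e), by fun_prop⟩
      map_add' := fun q r => by
        ext t
        · simp
        · simp [add_smul]; abel
      map_smul' := fun c q => by
        ext t
        · simp
        · simp [mul_smul, smul_comm c] } (1 + ‖e‖) (fun q => by
    refine (ContinuousMap.norm_le _ (by positivity)).2 fun t => ?_
    have h1 : ‖q.1‖ ≤ ‖q‖ := norm_fst_le q
    have h2 : ‖q.2 t‖ ≤ ‖q‖ := (q.2.norm_coe_le_norm t).trans (norm_snd_le q)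
    have h3 : ‖(t : ℝ)‖ ≤ 1 := by rw [Real.norm_of_nonneg t.2.1]; exact t.2.2
    have h4 : ‖(t : ℝ) • q.1 + q.2 t • e‖ ≤ (1 + ‖e‖) * ‖q‖ := by
      refine (norm_add_le _ _).trans ?_
      rw [norm_smul, norm_smul, add_mul, mul_comm ‖e‖]
      gcongr
    exact max_le (h1.trans (le_mul_of_one_le_left (norm_nonneg _) (by simp))) h4)

@[simp]
theorem curvePair_apply (e : E) (x : E) (z : C(I, ℝ)) (t : I) :
    curvePair e (x, z) t = (x, (t : ℝ) • x + z t • e) := rfl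

end Paths

/-! ### Frobenius: leaves and first integrals. -/

open unitInterval ContinuousMap in
/-- Leaves of `ker θ`, parametrized smoothly: near `0` there is a smooth map `Ψ` with `Ψ 0 = y₀` and
`DΨ(0) = id`, whose derivative maps `ker θ(y₀)` into `ker θ`. -/
theorem exists_contDiffOn_leaf_parametrization {E : Type} [NormedAddCommGroup E] [NormedSpace ℝ E]
    [CompleteSpace E] {U : Set E} (hU : IsOpen U) {θ : E → E →L[ℝ] ℝ}
    (hθ : ContDiffOn ℝ ∞ θ U) {e : E} (he : ∀ y ∈ U, θ y e = 1)
    (hint : ∀ y ∈ U, ∀ v w, θ y v = 0 → θ y w = 0 → fderiv ℝ θ y v w = fderiv ℝ θ y w v)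
    {y₀ : E} (hy₀ : y₀ ∈ U) :
    ∃ W : Set E, IsOpen W ∧ 0 ∈ W ∧ ∃ Ψ : E → E, ContDiffOn ℝ ∞ Ψ W ∧ Ψ 0 = y₀ ∧
      fderiv ℝ Ψ 0 = .id ℝ E ∧ ∀ w ∈ W, Ψ w ∈ U ∧
        ∀ v, θ y₀ v = 0 → θ (Ψ w) (fderiv ℝ Ψ w v) = 0 := by
  set l : E →L[ℝ] ℝ := θ y₀ with hl
  set π : E →L[ℝ] E := .id ℝ E - l.smulRight e with hπ
  have hπv : ∀ v, l v = 0 → π v = v := fun v hv => by simp [hπ, hv]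
  have hlπ : ∀ v, l (π v) = 0 := fun v => by simp [hπ, hl, he _ hy₀]
  let F : E × E → ℝ := fun q => θ q.2 q.1
  set O : Set (E × E) := Set.univ ×ˢ U with hO
  have hOo : IsOpen O := isOpen_univ.prod hU
  have hF : ContDiffOn ℝ ∞ F O :=
    (hθ.comp contDiff_snd.contDiffOn fun q hq => hq.2).clm_apply contDiff_fst.contDiffOn
  have hFd : ∀ q ∈ O, ∀ a b, fderiv ℝ F q (a, b) = θ q.2 a + fderiv ℝ θ q.2 b q.1 := by
    intro q hq a b
    have h1 := ((hθ.contDiffAt (hU.mem_nhds hq.2)).differentiableAt (by simp)).hasFDerivAt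
    have h2 : HasFDerivAt F _ q :=
      (h1.comp q hasFDerivAt_snd).clm_apply (hasFDerivAt_fst (E := E) (F := E))
    rw [h2.fderiv]
    simp
  let Λ : E × C(I, ℝ) →L[ℝ] C(I, E × E) :=
    (curvePair e).comp (π.prodMap (.id ℝ C(I, ℝ)))
  have hΛ : ∀ w z t, Λ (w, z) t = (π w, (t : ℝ) • π w + z t • e) := fun w z t => rfl
  let c : C(I, E × E) := ContinuousMap.const I (0, y₀)
  let S : Set C(I, E × E) := {γ | ∀ t, γ t ∈ O}
  have hS : IsOpen S := isOpen_setOf_forall_mem hOo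
  set k : ℝ →L[ℝ] C(I, ℝ) := ContinuousLinearMap.toSpanSingleton ℝ 1 with hk
  have hkt : ∀ r t, k r t = r := fun r t => by simp [hk]
  -- `G (w, z) = 0` says that `Γ(t) = y₀ + t π w + z(t) e` is tangent to `ker θ` and starts at `y₀ +
  -- l(w) e`. Taking `w` small, instead of short times, keeps the interval `[0,1]` fixed.
  let G : E × C(I, ℝ) → C(I, ℝ) := fun q =>
    q.2 - k (l q.1) + primitive (superposition F (Λ q + c))
  let D : Set (E × C(I, ℝ)) := (fun q => Λ q + c) ⁻¹' S
  have hΛc : ContDiff ℝ ∞ fun q => Λ q + c := Λ.contDiff.add contDiff_const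
  have hD : IsOpen D := hS.preimage hΛc.continuous
  have hG : ContDiffOn ℝ ∞ G D := by
    refine ContDiffOn.add ?_ ?_
    · exact (contDiff_snd.sub (k.contDiff.comp (l.contDiff.comp contDiff_fst))).contDiffOn
    · exact primitive.contDiff.comp_contDiffOn
        ((contDiffOn_superposition hOo hF).comp hΛc.contDiffOn fun q hq => hq)
  have hGd : ∀ q ∈ D, ∀ r, fderiv ℝ G q r = r.2 - k (l r.1) +
      primitive (pointwiseApply I (E × E) ℝ (superposition (fderiv ℝ F) (Λ q + c)) (Λ r)) := by
    intro q hq r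
    have h1 := (hasFDerivAt_superposition hOo (hF.of_le (by simp)) hq).comp q
      (Λ.hasFDerivAt.add_const c)
    have h2 : HasFDerivAt G _ q :=
      ((hasFDerivAt_snd (𝕜 := ℝ) (E := E) (F := C(I, ℝ)) (p := q)).sub
        ((k.comp l).hasFDerivAt.comp q hasFDerivAt_fst)).add (primitive.hasFDerivAt.comp q h1)
    rw [h2.fderiv]
    rfl
  have hF' : ContinuousOn (fderiv ℝ F) O := hF.continuousOn_fderiv_of_isOpen hOo (by simp)
  have hsd : ∀ q ∈ D, ∀ t a b, superposition (fderiv ℝ F) (Λ q + c) t (a, b) =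
      θ (Λ q t + c t).2 a + fderiv ℝ θ (Λ q t + c t).2 b (Λ q t + c t).1 := by
    intro q hq t a b
    rw [superposition_apply hF' hq, hFd _ (hq t)]
    rfl
  have h0D : (0, 0) ∈ D := by
    intro t
    simp only [ContinuousMap.add_apply, hΛ]
    simp [c, hO, hy₀]
  have hc0 : ∀ t, Λ (0, 0) t + c t = (0, y₀) := fun t => by rw [hΛ]; simp [c]
  have hG0 : G (0, 0) = 0 := by
    have : superposition F (Λ (0, 0) + c) = 0 := by
      ext t
      rw [superposition_apply hF.continuousOn h0D, ContinuousMap.add_apply, hc0]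
      simp [F]
    simp only [G, this]
    simp
  -- The integral term drops out since `l ∘ π = 0` and the velocity `π w` vanishes at `w = 0`; the
  -- partial derivative in `z` is thus the identity.
  have hd0 : ∀ r, fderiv ℝ G (0, 0) r = r.2 - k (l r.1) := by
    intro r
    rw [hGd _ h0D]
    have : pointwiseApply I (E × E) ℝ (superposition (fderiv ℝ F) (Λ (0, 0) + c)) (Λ r) = 0 := by
      ext t
      rw [pointwiseApply_apply, hΛ, hsd _ h0D, hc0]
      simpa using! hlπ r.1
    rw [this]; simp
  obtain ⟨W, hW, h0W, g, hg, hg0, hgG⟩ := exists_contDiffOn_implicitFunction hD hG h0D hG0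
    (.refl ℝ _) (fun v => by rw [hd0]; simp)
  have hgd : ∀ w ∈ W, HasFDerivAt g (fderiv ℝ g w) w := fun w hw =>
    ((hg.contDiffAt (hW.mem_nhds hw)).differentiableAt (by simp)).hasFDerivAt
  have hlin : ∀ w ∈ W, ∀ v, fderiv ℝ G (w, g w) (v, fderiv ℝ g w v) = 0 := by
    intro w hw v
    have h1 := ((hG.contDiffAt (hD.mem_nhds (hgG w hw).1)).differentiableAt (by simp)).hasFDerivAt
    have h2 := h1.comp w ((hasFDerivAt_id w).prodMk (hgd w hw))
    have h3 : HasFDerivAt (G ∘ fun w => (id w, g w)) (0 : E →L[ℝ] C(I, ℝ)) w :=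
      (hasFDerivAt_const (0 : C(I, ℝ)) w).congr_of_eventuallyEq
        (by filter_upwards [hW.mem_nhds hw] with w' hw' using (hgG w' hw').2.1)
    exact congrArg (fun T : E →L[ℝ] C(I, ℝ) => T v) (h2.unique h3)
  let ev : C(I, ℝ) →L[ℝ] ℝ := ContinuousMap.evalCLM ℝ (1 : I)
  -- The endpoint at `t = 1` of the curve with parameter `w`.
  let Ψ : E → E := fun w => y₀ + π w + (ev (g w)) • e
  have hΨd : ∀ w ∈ W, ∀ v, fderiv ℝ Ψ w v = π v + (fderiv ℝ g w v 1) • e := by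
    intro w hw v
    have h1 : HasFDerivAt Ψ _ w := (π.hasFDerivAt.const_add y₀).add
      ((ev.hasFDerivAt.comp w (hgd w hw)).smul_const e)
    rw [h1.fderiv]
    rfl
  refine ⟨W, hW, h0W, Ψ, ?_, ?_, ?_, fun w hw => ⟨?_, fun v hv => ?_⟩⟩
  · exact (contDiff_const.add π.contDiff).contDiffOn.add
      ((ev.contDiff.comp_contDiffOn hg).smul contDiffOn_const)
  · simp [Ψ, hg0]
  · ext v
    have h1 := hlin 0 h0W v
    rw [hg0, hd0, sub_eq_zero] at h1
    rw [hΨd 0 h0W, show fderiv ℝ g 0 v = k (l v) from h1, hkt]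
    simp [hπ]
  · have := ((hgG w hw).1 1).2
    simpa [Λ, c, Ψ, ev, add_comm, add_left_comm, add_assoc] using! this
  · have hDw := (hgG w hw).1
    have hpt : ∀ t, Λ (w, g w) t + c t = (π w, y₀ + (t : ℝ) • π w + g w t • e) := by
      intro t
      rw [hΛ]
      exact Prod.ext (by simp [c]) (by simp [c, add_comm, add_assoc])
    let f₁ : C(I, ℝ) := superposition F (Λ (w, g w) + c)
    let f₂ : C(I, ℝ) := pointwiseApply I (E × E) ℝ
      (superposition (fderiv ℝ F) (Λ (w, g w) + c)) (Λ (v, fderiv ℝ g w v))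
    -- `z` and `ζ` extend `g w` and its derivative along `v` to `ℝ`; their formulas are the integral
    -- equation and its linearization, where `l v = 0` gives `ζ 0 = 0`.
    let z : ℝ → ℝ := fun t => l w - ∫ s in (0 : ℝ)..t, f₁ (Set.projIcc 0 1 zero_le_one s)
    let ζ : ℝ → ℝ := fun t => -∫ s in (0 : ℝ)..t, f₂ (Set.projIcc 0 1 zero_le_one s)
    have hz : ∀ t : I, g w t = z t := by
      intro t
      have h1 := congrArg (fun f : C(I, ℝ) => f t) (hgG w hw).2.1
      simp only [G, ContinuousMap.add_apply, ContinuousMap.sub_apply, hkt, primitive_apply,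
        ContinuousMap.zero_apply] at h1
      simp only [z, f₁]
      linarith
    have hζ : ∀ t : I, fderiv ℝ g w v t = ζ t := by
      intro t
      have h1 := congrArg (fun f : C(I, ℝ) => f t) (hlin w hw v)
      rw [hGd _ hDw] at h1
      simp only [ContinuousMap.add_apply, ContinuousMap.sub_apply, hkt, primitive_apply,
        ContinuousMap.zero_apply] at h1
      rw [show l v = 0 from hv] at h1
      simp only [ζ, f₂]
      linarith
    have hmem : ∀ t : I, y₀ + (t : ℝ) • π w + g w t • e ∈ U := by
      intro t
      have := (hDw t).2
      rw [ContinuousMap.add_apply, hpt] at this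
      exact this
    have key := apply_variation_eq_zero hU hθ he hint (y₀ := y₀) (x := π w) (v := v) (z := z)
      (ζ := ζ) (Γ := fun t => y₀ + t • π w + z t • e) (fun t => rfl)
      (fun t ht => by simpa [hz] using! hmem ⟨t, ht⟩)
      (fun t ht => by
        refine ((hasDerivAt_integral_projIcc f₁ t).const_sub (l w)).congr_deriv ?_
        rw [Set.projIcc_of_mem _ ht]
        simp only [f₁]
        rw [superposition_apply hF.continuousOn hDw, ContinuousMap.add_apply, hpt, hz])
      (fun t ht => by
        refine (hasDerivAt_integral_projIcc f₂ t).neg.congr_deriv ?_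
        rw [Set.projIcc_of_mem _ ht]
        simp only [f₂]
        rw [pointwiseApply_apply, hΛ, hsd _ hDw, hpt, hz, hζ, hπv v hv])
      (by simp [ζ])
    rw [hΨd w hw, hπv v hv, hζ 1]
    simpa [Ψ, ev, hz] using! key

/-- Frobenius' theorem for a hyperplane field `ker θ`: if `dθ` vanishes on `ker θ`, then `θ` is
proportional to the differential of a function. -/
theorem exists_fderiv_eq_smul {E : Type} [NormedAddCommGroup E] [NormedSpace ℝ E]
    [CompleteSpace E] {U : Set E} (hU : IsOpen U) {θ : E → E →L[ℝ] ℝ}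
    (hθ : ContDiffOn ℝ ∞ θ U) {e : E} (he : ∀ y ∈ U, θ y e = 1)
    (hint : ∀ y ∈ U, ∀ v w, θ y v = 0 → θ y w = 0 → fderiv ℝ θ y v w = fderiv ℝ θ y w v)
    {y₀ : E} (hy₀ : y₀ ∈ U) :
    ∃ V : Set E, IsOpen V ∧ y₀ ∈ V ∧ V ⊆ U ∧ ∃ u : E → ℝ, ContDiffOn ℝ ∞ u V ∧
      ∀ y ∈ V, ∃ c : ℝ, c ≠ 0 ∧ fderiv ℝ u y = c • θ y := by
  obtain ⟨W, hW, h0W, Ψ, hΨ, hΨ0, hΨd0, hker⟩ :=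
    exists_contDiffOn_leaf_parametrization hU hθ he hint hy₀
  obtain ⟨Φ, h0, hsub, hΦ, hΦinv, hsymm⟩ := exists_openPartialHomeomorph_contDiffOn_symm hW hΨ h0W
    (by rw [hΨd0]; exact ⟨.refl ℝ E, rfl⟩)
  refine ⟨Φ.target, Φ.open_target, ?_, ?_, fun y => θ y₀ (Φ.symm y),
    (θ y₀).contDiff.comp_contDiffOn hsymm, ?_⟩
  · rw [← hΨ0, ← hΦ]; exact Φ.map_source h0
  · intro y hy
    have := (hker _ (hsub (Φ.map_target hy))).1
    rwa [← hΦ, Φ.right_inv hy] at this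
  · intro y hy
    have hw := Φ.map_target hy
    set w := Φ.symm y with hwdef
    have hyw : Ψ w = y := by rw [← hΦ, hwdef, Φ.right_inv hy]
    obtain ⟨hwU, hk⟩ := hker w (hsub hw)
    rw [hyw] at hwU hk
    obtain ⟨A, hA⟩ := hΦinv w hw
    rw [← hA] at hk
    have hd : HasFDerivAt Φ (A : E →L[ℝ] E) w := by
      rw [hA, show (Φ : E → E) = Ψ from funext hΦ]
      exact ((hΨ.contDiffAt (hW.mem_nhds (hsub hw))).differentiableAt (by simp)).hasFDerivAt
    have hds : HasFDerivAt Φ.symm (A.symm : E →L[ℝ] E) y := Φ.hasFDerivAt_symm hy hd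
    have hu : fderiv ℝ (fun y => θ y₀ (Φ.symm y)) y = (θ y₀).comp (A.symm : E →L[ℝ] E) :=
      ((θ y₀).hasFDerivAt.comp y hds).fderiv
    -- Subtracting its `e`-component puts `A⁻¹ v` in `ker θ(y₀)`, which `A = DΨ(w)` maps into `ker
    -- θ(y)`. The factor `θ y (A e)` is nonzero because `θ y e = 1`.
    have hprop : ∀ v, θ y v = θ y (A e) * θ y₀ (A.symm v) := by
      intro v
      have h1 := hk (A.symm v - θ y₀ (A.symm v) • e) (by simp [he _ hy₀])
      simp only [ContinuousLinearEquiv.coe_coe, map_sub, map_smul,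
        ContinuousLinearEquiv.apply_symm_apply, smul_eq_mul] at h1
      linarith
    have hc : θ y (A e) ≠ 0 := by
      intro h
      have := hprop e
      rw [he _ hwU, h, zero_mul] at this
      exact one_ne_zero this
    refine ⟨(θ y (A e))⁻¹, inv_ne_zero hc, ?_⟩
    rw [hu]
    ext v
    simp only [ContinuousLinearMap.comp_apply, ContinuousLinearEquiv.coe_coe, smul_apply,
      smul_eq_mul]
    rw [hprop v]
    field_simp

/-! ### Smooth continuation of simple eigencovectors. -/

section Eigencovector

variable {E : Type*} [NormedAddCommGroup E] [NormedSpace ℝ E] [FiniteDimensional ℝ E]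

/-- A simple eigencovector of a smooth family of operators extends smoothly; the extension is an
eigencovector of each operator commuting with the family. -/
theorem exists_contDiffOn_eigencovector {U : Set E} (hU : IsOpen U) {L : E → E →L[ℝ] E}
    (hL : ContDiffOn ℝ ∞ L U) {y₀ : E} (hy₀ : y₀ ∈ U) {l : E →L[ℝ] ℝ} {e : E} {r : ℝ}
    (hle : l e = 1) (hl : ∀ v, l (L y₀ v) = r * l v)
    (hsimple : ∀ (τ : E →L[ℝ] ℝ) (s : ℝ),
      (∀ v, τ (L y₀ v) = r * τ v + s * l v) → τ e = 0 → τ = 0 ∧ s = 0) :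
    ∃ W : Set E, IsOpen W ∧ y₀ ∈ W ∧ W ⊆ U ∧ ∃ θ : E → E →L[ℝ] ℝ, ContDiffOn ℝ ∞ θ W ∧ θ y₀ = l ∧
      ∀ y ∈ W, θ y e = 1 ∧ ∀ B : E →L[ℝ] E, (∀ v, B (L y v) = L y (B v)) →
        ∀ v, θ y (B v) = θ y (B e) * θ y v := by
  have : CompleteSpace E := FiniteDimensional.complete ℝ E
  -- The unknowns are the covector and its eigenvalue; the second equation fixes the scaling, and
  -- simplicity makes the linearization injective.
  let G : E × ((E →L[ℝ] ℝ) × ℝ) → (E →L[ℝ] ℝ) × ℝ := fun q =>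
    (q.2.1.comp (L q.1) - q.2.2 • q.2.1, q.2.1 e - 1)
  have hUo : IsOpen (U ×ˢ (Set.univ : Set ((E →L[ℝ] ℝ) × ℝ))) := hU.prod isOpen_univ
  have hG : ContDiffOn ℝ ∞ G (U ×ˢ Set.univ) := by
    have h1 : ContDiff ℝ ∞ fun q : E × ((E →L[ℝ] ℝ) × ℝ) => q.2.1 :=
      contDiff_fst.comp contDiff_snd
    have h2 : ContDiff ℝ ∞ fun q : E × ((E →L[ℝ] ℝ) × ℝ) => q.2.2 :=
      contDiff_snd.comp contDiff_snd
    refine ContDiffOn.prodMk (ContDiffOn.sub ?_ (h2.smul h1).contDiffOn) ?_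
    · exact h1.contDiffOn.clm_comp (hL.comp contDiff_fst.contDiffOn fun q hq => hq.1)
    · exact ((h1.clm_apply contDiff_const).sub contDiff_const).contDiffOn
  have hGd : ∀ y ∈ U, ∀ x v : (E →L[ℝ] ℝ) × ℝ, fderiv ℝ G (y, x) (0, v) =
      (v.1.comp (L y) - (x.2 • v.1 + v.2 • x.1), v.1 e) := by
    intro y hy x v
    have h1 := ((hG.contDiffAt (hUo.mem_nhds (Set.mk_mem_prod hy (Set.mem_univ x)))).differentiableAt
      (by simp)).hasFDerivAt
    have h2 := h1.comp x (hasFDerivAt_prodMk_right y x)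
    let C : (E →L[ℝ] ℝ) →L[ℝ] (E →L[ℝ] ℝ) := (ContinuousLinearMap.compL ℝ E E ℝ).flip (L y)
    let ev : (E →L[ℝ] ℝ) →L[ℝ] ℝ := ContinuousLinearMap.apply ℝ ℝ e
    have h3 : HasFDerivAt (G ∘ fun x => (y, x)) _ x :=
      ((C.hasFDerivAt.comp x hasFDerivAt_fst).sub
        ((hasFDerivAt_snd (𝕜 := ℝ) (E := E →L[ℝ] ℝ) (F := ℝ) (p := x)).smul hasFDerivAt_fst)).prodMk
        ((ev.hasFDerivAt.comp x hasFDerivAt_fst).sub_const 1)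
    have h4 := congrArg (fun T : (E →L[ℝ] ℝ) × ℝ →L[ℝ] (E →L[ℝ] ℝ) × ℝ => T v) (h2.unique h3)
    refine Eq.trans ?_ (h4.trans ?_)
    · simp
    · simp [C, ev]
  let T : ((E →L[ℝ] ℝ) × ℝ) →ₗ[ℝ] ((E →L[ℝ] ℝ) × ℝ) :=
    ((fderiv ℝ G (y₀, (l, r))).comp (ContinuousLinearMap.inr ℝ E ((E →L[ℝ] ℝ) × ℝ))).toLinearMap
  have hT : ∀ v, T v = fderiv ℝ G (y₀, (l, r)) (0, v) := fun v => rfl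
  have hTinj : Function.Injective T := by
    rw [← LinearMap.ker_eq_bot, LinearMap.ker_eq_bot']
    rintro ⟨τ, s⟩ hv
    rw [hT, hGd y₀ hy₀, Prod.mk_eq_zero] at hv
    obtain ⟨h1, h2⟩ := hsimple τ s (fun v => by
      have := congrArg (fun f : E →L[ℝ] ℝ => f v) hv.1
      simp at this
      linarith) hv.2
    rw [h1, h2]; rfl
  obtain ⟨W, hW, hyW, g, hg, hg0, hgG⟩ := exists_contDiffOn_implicitFunction hUo hG
    (p := y₀) (x := (l, r)) (Set.mk_mem_prod hy₀ (Set.mem_univ _))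
    (Prod.ext (by ext v; simp [G, hl]) (by simp [G, hle]))
    (LinearEquiv.ofInjectiveEndo T hTinj).toContinuousLinearEquiv (fun v => (hT v).symm)
  refine ⟨W, hW, hyW, fun y hy => (hgG y hy).1.1, fun y => (g y).1, contDiff_fst.comp_contDiffOn hg,
    by simp [hg0], fun y hy => ?_⟩
  obtain ⟨hyU, h0, hinj⟩ := hgG y hy
  have he1 : (g y).1 e = 1 := sub_eq_zero.1 (congrArg Prod.snd h0)
  have heig : ∀ v, (g y).1 (L y v) = (g y).2 * (g y).1 v := fun v =>
    sub_eq_zero.1 (congrArg (fun q : (E →L[ℝ] ℝ) × ℝ => q.1 v) h0)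
  refine ⟨he1, fun B hB v => ?_⟩
  -- Since `B` commutes with `L y`, the covector `θB - θ(Be)θ` has the same eigenvalue as `θ` and
  -- vanishes on `e`. It solves the linearized equation, hence is `0`.
  have h1 := hinj ((g y).1.comp B - (g y).1 (B e) • (g y).1, 0) (by
    rw [hGd y hyU.1]
    refine Prod.ext ?_ ?_
    · ext w
      simp [heig, hB]
      ring
    · simp [he1])
  have h2 := congrArg (fun q : (E →L[ℝ] ℝ) × ℝ => q.1 v) h1
  simp at h2
  linarith

end Eigencovector

/-! ### Spanning the kernel of a coframe element. -/

section Symmetric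

variable {E ι : Type*} [AddCommGroup E] [Module ℝ E] [Fintype ι] [DecidableEq ι]

/-- If linearly independent operators are diagonal with respect to a coframe `θ`, then their
deviations from scalars, evaluated at a generic vector of `ker (θ a)`, span `ker (θ a)`. -/
theorem bilinear_comm_on_ker_of_diagonal {θ : ι → E →ₗ[ℝ] ℝ} {A : ι → E →ₗ[ℝ] E}
    (hθ : Function.Bijective fun (v : E) (a : ι) => θ a v) {Λ : Matrix ι ι ℝ} (hΛ : Λ.det ≠ 0)
    (hA : ∀ i a v, θ a (A i v) = Λ i a * θ a v) (a : ι) (β : E →ₗ[ℝ] E →ₗ[ℝ] ℝ)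
    (hβ : ∀ ξ, θ a ξ = 0 → ∀ i j, β (Λ i a • ξ - A i ξ) (Λ j a • ξ - A j ξ) =
      β (Λ j a • ξ - A j ξ) (Λ i a • ξ - A i ξ)) {v w : E} (hv : θ a v = 0) (hw : θ a w = 0) :
    β v w = β w v := by
  obtain ⟨ξ, hξ⟩ := hθ.2 fun b => if b = a then 0 else 1
  have hξb : ∀ b, θ b ξ = if b = a then 0 else 1 := fun b => congrFun hξ b
  have hspan : ∀ v, θ a v = 0 → ∃ m : ι → ℝ, v = ∑ i, m i • (Λ i a • ξ - A i ξ) := by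
    intro v hv
    have hu : IsUnit Λ.det := isUnit_iff_ne_zero.2 hΛ
    -- The `b`-th component of the sum is `∑ mᵢ (Λᵢₐ - Λᵢᵦ)` for `b ≠ a`. Solving `m Λ = -θ(v)`
    -- makes it `θ_b(v)`, because `θ_a(v) = 0`.
    refine ⟨Matrix.vecMul (fun b => -θ b v) Λ⁻¹, ?_⟩
    set m := Matrix.vecMul (fun b => -θ b v) Λ⁻¹ with hm
    have hmΛ : ∀ b, ∑ i, m i * Λ i b = -θ b v := by
      intro b
      have : Matrix.vecMul m Λ = fun b => -θ b v := by
        rw [hm, Matrix.vecMul_vecMul, Matrix.nonsing_inv_mul _ hu, Matrix.vecMul_one]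
      exact congrFun this b
    apply hθ.1
    funext b
    have hsum : θ b (∑ i, m i • (Λ i a • ξ - A i ξ)) =
        ((∑ i, m i * Λ i a) - ∑ i, m i * Λ i b) * θ b ξ := by
      rw [map_sum, ← Finset.sum_sub_distrib, Finset.sum_mul]
      refine Finset.sum_congr rfl fun i _ => ?_
      simp only [map_smul, map_sub, hA, smul_eq_mul]
      ring
    change θ b v = θ b _
    rw [hsum, hmΛ, hmΛ, hξb, hv]
    split_ifs with h
    · rw [h, hv]; simp
    · ring
  obtain ⟨m, rfl⟩ := hspan v hv
  obtain ⟨m', rfl⟩ := hspan w hw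
  simp only [map_sum, LinearMap.sum_apply, map_smul, LinearMap.smul_apply, Finset.smul_sum]
  rw [Finset.sum_comm]
  refine Finset.sum_congr rfl fun i _ => Finset.sum_congr rfl fun j _ => ?_
  rw [hβ ξ (by simp [hξb]) j i, smul_comm]

end Symmetric

/-! ### The integrability identity from the symmetry condition. -/

section DifferentialIdentity

variable {E : Type*} [NormedAddCommGroup E] [NormedSpace ℝ E]

/-- A common eigencovector field `θ` of two operator fields `A`, `B` with vanishing symmetrized
concomitant satisfies `dθ ((α - A) ξ, (β - B) ξ) = 0` for `ξ` in `ker θ`. -/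
theorem fderiv_eigencovector_comm {U : Set E} (hU : IsOpen U) {θ : E → E →L[ℝ] ℝ}
    (hθ : ContDiffOn ℝ ∞ θ U) {A B : E → E →L[ℝ] E} (hA : ContDiffOn ℝ ∞ A U)
    (hB : ContDiffOn ℝ ∞ B U) {e : E}
    (hθA : ∀ y ∈ U, ∀ v, θ y (A y v) = θ y (A y e) * θ y v)
    (hθB : ∀ y ∈ U, ∀ v, θ y (B y v) = θ y (B y e) * θ y v) {y : E} (hy : y ∈ U) {ξ : E}
    (hAB : -B y (fderiv ℝ A y ξ ξ) + A y (fderiv ℝ B y ξ ξ) - fderiv ℝ B y (A y ξ) ξ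
      + fderiv ℝ A y (B y ξ) ξ = 0) (hξ : θ y ξ = 0) :
    fderiv ℝ θ y (θ y (A y e) • ξ - A y ξ) (θ y (B y e) • ξ - B y ξ) =
      fderiv ℝ θ y (θ y (B y e) • ξ - B y ξ) (θ y (A y e) • ξ - A y ξ) := by
  have hθd := ((hθ.contDiffAt (hU.mem_nhds hy)).differentiableAt (by simp)).hasFDerivAt
  -- Differentiate the eigencovector equation along `η` with `ξ` constant; the derivative of the
  -- eigenvalue is multiplied by `θ(ξ) = 0`.
  have key : ∀ A : E → E →L[ℝ] E, ContDiffOn ℝ ∞ A U →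
      (∀ y ∈ U, ∀ v, θ y (A y v) = θ y (A y e) * θ y v) → ∀ η,
      θ y (fderiv ℝ A y η ξ) = fderiv ℝ θ y η (θ y (A y e) • ξ - A y ξ) := by
    intro A hA hθA η
    have hAd := ((hA.contDiffAt (hU.mem_nhds hy)).differentiableAt (by simp)).hasFDerivAt
    have h1 : HasFDerivAt (fun y => θ y (A y ξ)) _ y :=
      hθd.clm_apply (hAd.clm_apply (hasFDerivAt_const ξ y))
    have h2 : HasFDerivAt (fun y => θ y (A y e) * θ y ξ) _ y :=
      (hθd.clm_apply (hAd.clm_apply (hasFDerivAt_const e y))).mul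
        (hθd.clm_apply (hasFDerivAt_const ξ y))
    have h3 := h2.congr_of_eventuallyEq
      (f₁ := fun y => θ y (A y ξ)) (by filter_upwards [hU.mem_nhds hy] with y' hy' using hθA y' hy' ξ)
    have h4 := congrArg (fun T : E →L[ℝ] ℝ => T η) (h1.unique h3)
    simp [hξ] at h4
    simp only [map_sub, map_smul, smul_eq_mul]
    linarith
  have h := congrArg (θ y) hAB
  simp only [map_add, map_sub, map_neg, map_zero, hθA y hy (fderiv ℝ B y ξ ξ),
    hθB y hy (fderiv ℝ A y ξ ξ), key A hA hθA, key B hB hθB] at h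
  simp only [map_sub, map_smul, sub_apply, smul_apply, smul_eq_mul] at h ⊢
  linarith

end DifferentialIdentity

/-! ### The local theorem in Euclidean space. -/

/-- The coordinate form of the theorem: commuting operator fields with vanishing symmetrized
concomitants, linearly independent at `y₀` and with a combination of simple real spectrum there,
are simultaneously diagonal in suitable coordinates. -/
theorem exists_diagonalizing_coordinates {n : ℕ}
    {A : Fin n → EuclideanSpace ℝ (Fin n) →
      EuclideanSpace ℝ (Fin n) →L[ℝ] EuclideanSpace ℝ (Fin n)}
    {U : Set (EuclideanSpace ℝ (Fin n))} (hU : IsOpen U) (hA : ∀ i, ContDiffOn ℝ ∞ (A i) U)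
    (hcomm : ∀ y ∈ U, ∀ i j v, A i y (A j y v) = A j y (A i y v))
    (hsymm : ∀ y ∈ U, ∀ i j ξ, -A j y (fderiv ℝ (A i) y ξ ξ) + A i y (fderiv ℝ (A j) y ξ ξ)
      - fderiv ℝ (A j) y (A i y ξ) ξ + fderiv ℝ (A i) y (A j y ξ) ξ = 0)
    {y₀ : EuclideanSpace ℝ (Fin n)} (hy₀ : y₀ ∈ U) (hind : LinearIndependent ℝ fun i => A i y₀)
    {c μ : Fin n → ℝ} (hμ : Function.Injective μ)
    (heig : ∀ j, Module.End.HasEigenvalue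
      ((∑ i, c i • A i y₀ : EuclideanSpace ℝ (Fin n) →L[ℝ] EuclideanSpace ℝ (Fin n)) :
        EuclideanSpace ℝ (Fin n) →ₗ[ℝ] EuclideanSpace ℝ (Fin n)) (μ j)) :
    ∃ Φ : OpenPartialHomeomorph (EuclideanSpace ℝ (Fin n)) (EuclideanSpace ℝ (Fin n)),
      y₀ ∈ Φ.source ∧ Φ.source ⊆ U ∧ ContDiffOn ℝ ∞ Φ Φ.source ∧
      ContDiffOn ℝ ∞ Φ.symm Φ.target ∧ ∀ y ∈ Φ.source, (fderiv ℝ Φ y).IsInvertible ∧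
        ∀ i a, ∃ r : ℝ, ∀ v, fderiv ℝ Φ y (A i y v) a = r * fderiv ℝ Φ y v a := by
  set L : EuclideanSpace ℝ (Fin n) → EuclideanSpace ℝ (Fin n) →L[ℝ] EuclideanSpace ℝ (Fin n) :=
    fun y => ∑ i, c i • A i y with hLdef
  have hL : ContDiffOn ℝ ∞ L U := ContDiffOn.sum fun i _ => (hA i).const_smul (c i)
  choose e he using fun j => (heig j).exists_hasEigenvector
  have hLe : ∀ j, L y₀ (e j) = μ j • e j := fun j => (he j).apply_eq_smul
  have heind : LinearIndependent ℝ e :=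
    Module.End.eigenvectors_linearIndependent' _ μ hμ e he
  let b : Module.Basis (Fin n) ℝ (EuclideanSpace ℝ (Fin n)) :=
    Module.Basis.mk heind (heind.span_eq_top_of_card_eq_finrank' (by simp)).ge
  have hb : ∀ j, b j = e j := fun j => by simp [b]
  let l : Fin n → EuclideanSpace ℝ (Fin n) →L[ℝ] ℝ := fun a => (b.coord a).toContinuousLinearMap
  have hlb : ∀ a j, l a (e j) = if j = a then 1 else 0 := by
    intro a j
    rw [← hb]
    simp [l, Finsupp.single_apply]
  have hll : ∀ a v, l a (L y₀ v) = μ a * l a v := by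
    intro a v
    have : (l a).toLinearMap ∘ₗ (L y₀).toLinearMap = μ a • (l a).toLinearMap := by
      refine b.ext fun j => ?_
      simp only [LinearMap.comp_apply, LinearMap.smul_apply, ContinuousLinearMap.coe_coe, hb, hLe,
        map_smul, hlb, smul_eq_mul]
      split_ifs with h
      · rw [h]
      · simp
    exact congrArg (fun T : EuclideanSpace ℝ (Fin n) →ₗ[ℝ] ℝ => T v) this
  have hsimple : ∀ a (τ : EuclideanSpace ℝ (Fin n) →L[ℝ] ℝ) (s : ℝ),
      (∀ v, τ (L y₀ v) = μ a * τ v + s * l a v) → τ (e a) = 0 → τ = 0 ∧ s = 0 := by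
    intro a τ s h h0
    have hs : s = 0 := by
      have := h (e a)
      simpa [hLe, hlb, h0] using this.symm
    refine ⟨?_, hs⟩
    have : τ.toLinearMap = 0 := by
      refine b.ext fun j => ?_
      simp only [ContinuousLinearMap.coe_coe, hb, LinearMap.zero_apply]
      by_cases hj : j = a
      · rw [hj, h0]
      · have h1 := h (e j)
        rw [hLe, map_smul, hs, zero_mul, add_zero, smul_eq_mul, ← sub_eq_zero, ← sub_mul] at h1
        exact (mul_eq_zero.1 h1).resolve_left (sub_ne_zero.2 fun h' => hj (hμ h'))
    ext v
    exact congrArg (fun T : EuclideanSpace ℝ (Fin n) →ₗ[ℝ] ℝ => T v) this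
  choose W hW hyW hWU θ hθ hθ0 hθW using fun a => exists_contDiffOn_eigencovector hU hL hy₀
    (l := l a) (e := e a) (r := μ a) (by simp [hlb]) (hll a) (hsimple a)
  have hLcomm : ∀ y ∈ U, ∀ i v, A i y (L y v) = L y (A i y v) := by
    intro y hy i v
    simp only [hLdef, sum_apply, smul_apply, map_sum, map_smul]
    exact Finset.sum_congr rfl fun j _ => by rw [hcomm y hy]
  let Λ : EuclideanSpace ℝ (Fin n) → Matrix (Fin n) (Fin n) ℝ := fun y =>
    Matrix.of fun i a => θ a y (A i y (e a))
  let T : EuclideanSpace ℝ (Fin n) → Matrix (Fin n) (Fin n) ℝ := fun y =>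
    Matrix.of fun a j => θ a y (e j)
  have hθA : ∀ y, (∀ a, y ∈ W a) → ∀ a i v, θ a y (A i y v) = Λ y i a * θ a y v := fun y hy a i v =>
    (hθW a y (hy a)).2 (A i y) (hLcomm y (hWU a (hy a)) i) v
  have hyWa : ∀ a, y₀ ∈ W a := hyW
  have hT0 : (T y₀).det ≠ 0 := by
    have : T y₀ = 1 := by
      ext a j
      simp only [T, Matrix.of_apply, hθ0, hlb, Matrix.one_apply]
      simp only [eq_comm]
    rw [this, Matrix.det_one]; exact one_ne_zero
  -- A left null vector `m` of `Λ(y₀)` would make every eigenvalue of `∑ mᵢ Aᵢ(y₀)` vanish in the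
  -- dual eigenbasis, contradicting independence.
  have hΛ0 : (Λ y₀).det ≠ 0 := by
    intro h0
    obtain ⟨m, hm, hm0⟩ := Matrix.exists_vecMul_eq_zero_iff.2 h0
    apply hm
    have hsum : ∑ i, m i • A i y₀ = 0 := by
      ext1 v
      apply b.ext_elem
      intro a
      change l a ((∑ i, m i • A i y₀) v) = l a 0
      simp only [sum_apply, smul_apply, map_sum, map_smul, map_zero,
        smul_eq_mul]
      have h1 : ∑ i, m i * Λ y₀ i a = 0 := congrFun hm0 a
      calc ∑ i, m i * l a (A i y₀ v) = (∑ i, m i * Λ y₀ i a) * l a v := by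
            rw [Finset.sum_mul]
            refine Finset.sum_congr rfl fun i _ => ?_
            rw [← hθ0, hθA y₀ hyWa]; ring
        _ = 0 := by rw [h1, zero_mul]
    exact funext (Fintype.linearIndependent_iff.1 hind m hsum)
  set W₁ : Set (EuclideanSpace ℝ (Fin n)) := U ∩ ⋂ a, W a with hW₁
  have hW₁o : IsOpen W₁ := hU.inter (isOpen_iInter_of_finite hW)
  have hW₁a : ∀ y ∈ W₁, ∀ a, y ∈ W a := fun y hy => Set.mem_iInter.1 hy.2
  have hθc : ∀ a, ContinuousOn (θ a) W₁ := fun a =>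
    (hθ a).continuousOn.mono fun y hy => hW₁a y hy a
  have hAc : ∀ i, ContinuousOn (A i) W₁ := fun i => (hA i).continuousOn.mono fun y hy => hy.1
  have hdet : ContinuousOn (fun y => (T y).det * (Λ y).det) W₁ := by
    refine ContinuousOn.mul ?_ ?_
    · refine continuous_id.matrix_det.comp_continuousOn (continuousOn_pi.2 fun a =>
        continuousOn_pi.2 fun j => (hθc a).clm_apply continuousOn_const)
    · refine continuous_id.matrix_det.comp_continuousOn (continuousOn_pi.2 fun i =>
        continuousOn_pi.2 fun a => (hθc a).clm_apply ((hAc i).clm_apply continuousOn_const))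
  -- Here the `θ_a` form a coframe (`det T ≠ 0`) and the spanning argument applies (`det Λ ≠ 0`).
  set W₂ : Set (EuclideanSpace ℝ (Fin n)) := W₁ ∩ (fun y => (T y).det * (Λ y).det) ⁻¹' {0}ᶜ
    with hW₂
  have hW₂o : IsOpen W₂ := hdet.isOpen_inter_preimage hW₁o isOpen_compl_singleton
  have hy₂ : y₀ ∈ W₂ := ⟨⟨hy₀, Set.mem_iInter.2 hyW⟩, mul_ne_zero hT0 hΛ0⟩
  have hθ₂ : ∀ a, ContDiffOn ℝ ∞ (θ a) W₂ := fun a => (hθ a).mono fun y hy => hW₁a y hy.1 a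
  have hA₂ : ∀ i, ContDiffOn ℝ ∞ (A i) W₂ := fun i => (hA i).mono fun y hy => hy.1.1
  have hbij : ∀ y ∈ W₂, Function.Bijective
      fun (v : EuclideanSpace ℝ (Fin n)) (a : Fin n) => θ a y v := by
    intro y hy
    have hTu : IsUnit (T y).det := isUnit_iff_ne_zero.2 (left_ne_zero_of_mul hy.2)
    let M : EuclideanSpace ℝ (Fin n) →ₗ[ℝ] (Fin n → ℝ) :=
      LinearMap.pi fun a => (θ a y : EuclideanSpace ℝ (Fin n) →ₗ[ℝ] ℝ)
    have hsurj : Function.Surjective M := by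
      intro x
      refine ⟨∑ j, ((T y)⁻¹.mulVec x) j • e j, ?_⟩
      have h1 : (T y).mulVec ((T y)⁻¹.mulVec x) = x := by
        rw [Matrix.mulVec_mulVec, Matrix.mul_nonsing_inv _ hTu, Matrix.one_mulVec]
      funext a
      rw [← congrFun h1 a]
      simp only [M, LinearMap.pi_apply, ContinuousLinearMap.coe_coe, map_sum, map_smul, smul_eq_mul]
      exact Finset.sum_congr rfl fun j _ => mul_comm _ _
    exact ⟨(LinearMap.injective_iff_surjective_of_finrank_eq_finrank (by simp)).2 hsurj, hsurj⟩
  have hint : ∀ a, ∀ y ∈ W₂, ∀ v w, θ a y v = 0 → θ a y w = 0 →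
      fderiv ℝ (θ a) y v w = fderiv ℝ (θ a) y w v := by
    intro a y hy v w hv hw
    refine bilinear_comm_on_ker_of_diagonal (θ := fun a => (θ a y).toLinearMap)
      (A := fun i => (A i y).toLinearMap) (hbij y hy) (Λ := Λ y) (right_ne_zero_of_mul hy.2)
      (fun i a v => hθA y (hW₁a y hy.1) a i v) a
      ((ContinuousLinearMap.coeLM ℝ).comp (fderiv ℝ (θ a) y).toLinearMap) ?_ hv hw
    intro ξ hξ i j
    exact fderiv_eigencovector_comm hW₂o (hθ₂ a) (hA₂ i) (hA₂ j) (e := e a)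
      (fun y hy v => hθA y (hW₁a y hy.1) a i v) (fun y hy v => hθA y (hW₁a y hy.1) a j v) hy
      (hsymm y hy.1.1 i j ξ) hξ
  choose V hV hyV hVW u hu hdu using fun a => exists_fderiv_eq_smul hW₂o (hθ₂ a)
    (fun y hy => (hθW a y (hW₁a y hy.1 a)).1) (hint a) hy₂
  let f : EuclideanSpace ℝ (Fin n) → EuclideanSpace ℝ (Fin n) := fun y =>
    WithLp.toLp 2 fun a => u a y
  set V₁ : Set (EuclideanSpace ℝ (Fin n)) := W₂ ∩ ⋂ a, V a with hV₁
  have hV₁o : IsOpen V₁ := hW₂o.inter (isOpen_iInter_of_finite hV)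
  have hV₁a : ∀ y ∈ V₁, ∀ a, y ∈ V a := fun y hy => Set.mem_iInter.1 hy.2
  have hf : ContDiffOn ℝ ∞ f V₁ :=
    contDiffOn_piLp' 2 fun a => (hu a).mono fun y hy => hV₁a y hy a
  have hfd : ∀ y ∈ V₁, ∀ v a, fderiv ℝ f y v a = fderiv ℝ (u a) y v := by
    intro y hy v a
    have h1 := ((hf.contDiffAt (hV₁o.mem_nhds hy)).differentiableAt (by simp)).hasFDerivAt
    have h2 : HasFDerivAt (u a) _ y :=
      (EuclideanSpace.proj (𝕜 := ℝ) a).hasFDerivAt.comp y h1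
    rw [h2.fderiv]
    rfl
  -- The `du_a` are nonzero multiples of the coframe `θ_a`, hence independent.
  have hinv : ∀ y ∈ V₁, (fderiv ℝ f y).IsInvertible := by
    intro y hy
    have hinj : Function.Injective (fderiv ℝ f y).toLinearMap := by
      rw [← LinearMap.ker_eq_bot, LinearMap.ker_eq_bot']
      intro v hv
      apply (hbij y hy.1).1
      funext a
      obtain ⟨r, hr, hdr⟩ := hdu a y (hV₁a y hy a)
      have h1 := hfd y hy v a
      rw [show fderiv ℝ f y v = 0 from hv, hdr] at h1
      have h2 : 0 = r * θ a y v := h1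
      simpa [hr] using h2.symm
    exact ⟨(LinearEquiv.ofInjectiveEndo _ hinj).toContinuousLinearEquiv, by ext v; rfl⟩
  have hyV₁ : y₀ ∈ V₁ := ⟨hy₂, Set.mem_iInter.2 hyV⟩
  obtain ⟨Φ, h0, hsub, hΦ, -, hsymmΦ⟩ :=
    exists_openPartialHomeomorph_contDiffOn_symm hV₁o hf hyV₁ (hinv y₀ hyV₁)
  have hΦf : (Φ : EuclideanSpace ℝ (Fin n) → EuclideanSpace ℝ (Fin n)) = f := funext hΦ
  refine ⟨Φ, h0, fun y hy => (hsub hy).1.1.1, by rw [hΦf]; exact hf.mono hsub, hsymmΦ,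
    fun y hy => ?_⟩
  rw [hΦf]
  refine ⟨hinv y (hsub hy), fun i a => ⟨Λ y i a, fun v => ?_⟩⟩
  obtain ⟨r, hr, hdr⟩ := hdu a y (hV₁a y (hsub hy) a)
  rw [hfd y (hsub hy), hfd y (hsub hy), hdr, smul_apply, smul_apply,
    hθA y (hW₁a y (hsub hy).1.1) a i v]
  simp only [smul_eq_mul]
  ring

/-! ### Transfer of operator fields and brackets to a chart. -/

namespace OperatorField

open VectorField

variable {n : ℕ} {M : Type*} [TopologicalSpace M]
  [ChartedSpace (EuclideanSpace ℝ (Fin n)) M] [IsManifold (𝓡 n) ∞ M]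

/-- The operator field `A` at `x`, read in the chart at `p`. -/
def inChart (A : OperatorField n M) (p x : M) :
    EuclideanSpace ℝ (Fin n) →L[ℝ] EuclideanSpace ℝ (Fin n) :=
  ContinuousLinearMap.inCoordinates (EuclideanSpace ℝ (Fin n)) (TangentSpace (𝓡 n) : M → Type)
    (EuclideanSpace ℝ (Fin n)) (TangentSpace (𝓡 n) : M → Type) p x p x (A x)

/-- The derivative of the chart at `p`. -/
def chartDeriv (p x : M) : TangentSpace (𝓡 n) x →L[ℝ] EuclideanSpace ℝ (Fin n) :=
  (trivializationAt (EuclideanSpace ℝ (Fin n)) (TangentSpace (𝓡 n)) p).continuousLinearMapAt ℝ x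

theorem chartDeriv_eq_mfderiv {p x : M}
    (hx : x ∈ (chartAt (EuclideanSpace ℝ (Fin n)) p).source) :
    chartDeriv p x = mfderiv (𝓡 n) (𝓡 n) (extChartAt (𝓡 n) p) x :=
  TangentBundle.continuousLinearMapAt_trivializationAt hx

theorem isInvertible_chartDeriv {p x : M}
    (hx : x ∈ (chartAt (EuclideanSpace ℝ (Fin n)) p).source) :
    (chartDeriv (n := n) p x).IsInvertible := by
  rw [chartDeriv_eq_mfderiv hx]
  exact isInvertible_mfderiv_extChartAt (by simpa using hx)

theorem inChart_chartDeriv (A : OperatorField n M) {p x : M}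
    (hx : x ∈ (chartAt (EuclideanSpace ℝ (Fin n)) p).source) (v : TangentSpace (𝓡 n) x) :
    A.inChart p x (chartDeriv p x v) = chartDeriv p x (A x v) := by
  simp only [inChart, ContinuousLinearMap.inCoordinates, ContinuousLinearMap.comp_apply, chartDeriv]
  rw [Bundle.Trivialization.symmL_continuousLinearMapAt _ (by simpa using hx)]

theorem contMDiffOn_inChart (A : OperatorField n M) (p : M) :
    ContMDiffOn (𝓡 n) 𝓘(ℝ, EuclideanSpace ℝ (Fin n) →L[ℝ] EuclideanSpace ℝ (Fin n)) ∞
      (A.inChart p) (chartAt (EuclideanSpace ℝ (Fin n)) p).source := by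
  have h := (Bundle.Trivialization.contMDiffOn_section_iff
    (trivializationAt (EuclideanSpace ℝ (Fin n) →L[ℝ] EuclideanSpace ℝ (Fin n))
      (fun x : M => TangentSpace (𝓡 n) x →L[ℝ] TangentSpace (𝓡 n) x) p)
    (chartAt (EuclideanSpace ℝ (Fin n)) p).open_source (IB := 𝓡 n) (n := ∞) (s := fun x => A x)
    (by simp)).1 A.contMDiff.contMDiffOn
  exact h

/-- The vector field whose representation in the chart at `p` is `X`. -/
def liftField (p : M) (X : EuclideanSpace ℝ (Fin n) → EuclideanSpace ℝ (Fin n)) :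
    Π x : M, TangentSpace (𝓡 n) x :=
  mpullback (𝓡 n) (𝓡 n) (extChartAt (𝓡 n) p) X

theorem chartDeriv_liftField {p x : M}
    (hx : x ∈ (chartAt (EuclideanSpace ℝ (Fin n)) p).source)
    (X : EuclideanSpace ℝ (Fin n) → EuclideanSpace ℝ (Fin n)) :
    chartDeriv p x (liftField p X x) = X (chartAt (EuclideanSpace ℝ (Fin n)) p x) := by
  rw [chartDeriv_eq_mfderiv hx]
  exact (isInvertible_mfderiv_extChartAt (by simpa using hx)).self_apply_inverse _

/-- Lie brackets are natural under pullback by the chart. -/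
theorem chartDeriv_mlieBracket_liftField {p x : M}
    (hx : x ∈ (chartAt (EuclideanSpace ℝ (Fin n)) p).source)
    {X Y : EuclideanSpace ℝ (Fin n) → EuclideanSpace ℝ (Fin n)}
    (hX : ContDiffAt ℝ 1 X (chartAt (EuclideanSpace ℝ (Fin n)) p x))
    (hY : ContDiffAt ℝ 1 Y (chartAt (EuclideanSpace ℝ (Fin n)) p x)) :
    chartDeriv p x (mlieBracket (𝓡 n) (liftField p X) (liftField p Y) x) =
      lieBracket ℝ X Y (chartAt (EuclideanSpace ℝ (Fin n)) p x) := by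
  have : IsManifold (𝓡 n) (minSmoothness ℝ 2) M := by
    rw [minSmoothness_of_isRCLikeNormedField]
    infer_instance
  have h := mpullback_mlieBracket (I := 𝓡 n) (I' := 𝓡 n) (n := minSmoothness ℝ 2)
    (f := extChartAt (𝓡 n) p) (V := X) (W := Y) (x₀ := x)
    ((contMDiffAt_vectorSpace_iff_contDiffAt.2 hX).mdifferentiableAt one_ne_zero)
    ((contMDiffAt_vectorSpace_iff_contDiffAt.2 hY).mdifferentiableAt one_ne_zero)
    (contMDiffAt_extChartAt' hx) le_rfl
  change chartDeriv p x (mlieBracket (𝓡 n) (mpullback (𝓡 n) (𝓡 n) (extChartAt (𝓡 n) p) X)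
    (mpullback (𝓡 n) (𝓡 n) (extChartAt (𝓡 n) p) Y) x) = _
  rw [← h]
  refine (chartDeriv_liftField hx _).trans ?_
  have h2 := mlieBracketWithin_eq_lieBracketWithin (𝕜 := ℝ) (V := X) (W := Y) (s := Set.univ)
  have h3 := mlieBracketWithin_univ (I := 𝓡 n) (V := X) (W := Y)
  exact (congrFun h3.symm _).trans (congrFun (h2.trans lieBracketWithin_univ) _)

theorem smoothVectorFieldOn_liftField (p : M)
    {X : EuclideanSpace ℝ (Fin n) → EuclideanSpace ℝ (Fin n)} (hX : ContDiff ℝ ∞ X) :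
    SmoothVectorFieldOn (liftField p X) (chartAt (EuclideanSpace ℝ (Fin n)) p).source := by
  intro x hx
  refine (ContMDiffAt.mpullback_vectorField_preimage (n := ∞) ?_ (contMDiffAt_extChartAt' hx)
    (isInvertible_mfderiv_extChartAt (by simpa using hx)) (by simp)).contMDiffWithinAt
  exact contMDiffAt_vectorSpace_iff_contDiffAt.2 hX.contDiffAt

theorem apply_liftField (A : OperatorField n M) {p x : M}
    (hx : x ∈ (chartAt (EuclideanSpace ℝ (Fin n)) p).source)
    (X : EuclideanSpace ℝ (Fin n) → EuclideanSpace ℝ (Fin n)) :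
    A x (liftField p X x) = liftField p
      (fun y => A.inChart p ((chartAt (EuclideanSpace ℝ (Fin n)) p).symm y) (X y)) x := by
  apply (isInvertible_chartDeriv hx).injective
  rw [chartDeriv_liftField hx, ← inChart_chartDeriv A hx, chartDeriv_liftField hx,
    (chartAt (EuclideanSpace ℝ (Fin n)) p).left_inv hx]

theorem contDiffOn_inChart_symm (A : OperatorField n M) (p : M) :
    ContDiffOn ℝ ∞ (fun y => A.inChart p ((chartAt (EuclideanSpace ℝ (Fin n)) p).symm y))
      (chartAt (EuclideanSpace ℝ (Fin n)) p).target := by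
  rw [← contMDiffOn_iff_contDiffOn]
  exact (A.contMDiffOn_inChart p).comp (contMDiffOn_chart_symm (I := 𝓡 n) (x := p))
    fun y hy => (chartAt (EuclideanSpace ℝ (Fin n)) p).map_target hy

theorem IsSymmetry.inChart_comm {A B : OperatorField n M} (h : IsSymmetry A B) {p x : M}
    (hx : x ∈ (chartAt (EuclideanSpace ℝ (Fin n)) p).source) (v : EuclideanSpace ℝ (Fin n)) :
    A.inChart p x (B.inChart p x v) = B.inChart p x (A.inChart p x v) := by
  obtain ⟨w, rfl⟩ := (isInvertible_chartDeriv hx).surjective v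
  rw [inChart_chartDeriv B hx, inChart_chartDeriv A hx, inChart_chartDeriv A hx,
    inChart_chartDeriv B hx]
  exact congrArg (fun T : TangentSpace (𝓡 n) x →L[ℝ] TangentSpace (𝓡 n) x => chartDeriv p x (T w))
    (h.1 x)

/-- The symmetry condition in a chart, on constant vector fields. -/
theorem IsSymmetry.fderiv_inChart {A B : OperatorField n M} (h : IsSymmetry A B) (p : M)
    {A' B' : EuclideanSpace ℝ (Fin n) → EuclideanSpace ℝ (Fin n) →L[ℝ] EuclideanSpace ℝ (Fin n)}
    (hA' : A' = fun y => A.inChart p ((chartAt (EuclideanSpace ℝ (Fin n)) p).symm y))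
    (hB' : B' = fun y => B.inChart p ((chartAt (EuclideanSpace ℝ (Fin n)) p).symm y))
    {y : EuclideanSpace ℝ (Fin n)} (hy : y ∈ (chartAt (EuclideanSpace ℝ (Fin n)) p).target)
    (v : EuclideanSpace ℝ (Fin n)) :
    -B' y (fderiv ℝ A' y v v) + A' y (fderiv ℝ B' y v v) - fderiv ℝ B' y (A' y v) v
      + fderiv ℝ A' y (B' y v) v = 0 := by
  set φ := chartAt (EuclideanSpace ℝ (Fin n)) p with hφ
  obtain ⟨x, hx, rfl⟩ : ∃ x ∈ φ.source, φ x = y := ⟨φ.symm y, φ.map_target hy, φ.right_inv hy⟩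
  have hdiff : ∀ C : OperatorField n M, ContDiffAt ℝ 1 (fun y => C.inChart p (φ.symm y)) (φ x) :=
    fun C => ((C.contDiffOn_inChart_symm p).contDiffAt (φ.open_target.mem_nhds hy)).of_le (by simp)
  have hdA : ContDiffAt ℝ 1 A' (φ x) := hA' ▸ hdiff A
  have hdB : ContDiffAt ℝ 1 B' (φ x) := hB' ▸ hdiff B
  have hfd : ∀ {C : EuclideanSpace ℝ (Fin n) → EuclideanSpace ℝ (Fin n) →L[ℝ]
      EuclideanSpace ℝ (Fin n)}, ContDiffAt ℝ 1 C (φ x) → ∀ η,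
      fderiv ℝ (fun y => C y v) (φ x) η = fderiv ℝ C (φ x) η v := by
    intro C hC η
    rw [((hC.differentiableAt one_ne_zero).hasFDerivAt.clm_apply (hasFDerivAt_const v (φ x))).fderiv]
    simp
  have hdAv : ContDiffAt ℝ 1 (fun y => A' y v) (φ x) := hdA.clm_apply contDiffAt_const
  have hdBv : ContDiffAt ℝ 1 (fun y => B' y v) (φ x) := hdB.clm_apply contDiffAt_const
  have hdc : ContDiffAt ℝ 1 (fun _ : EuclideanSpace ℝ (Fin n) => v) (φ x) := contDiffAt_const
  have hA : ∀ z ∈ φ.source, ∀ w, chartDeriv p z (A z w) = A' (φ z) (chartDeriv p z w) := by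
    intro z hz w
    rw [← inChart_chartDeriv A hz, hA']
    exact congrArg (fun q => A.inChart p q (chartDeriv p z w)) (φ.left_inv hz).symm
  have hB : ∀ z ∈ φ.source, ∀ w, chartDeriv p z (B z w) = B' (φ z) (chartDeriv p z w) := by
    intro z hz w
    rw [← inChart_chartDeriv B hz, hB']
    exact congrArg (fun q => B.inChart p q (chartDeriv p z w)) (φ.left_inv hz).symm
  have hnhds : φ.source ∈ 𝓝 x := φ.open_source.mem_nhds hx
  let ξ : Π z : M, TangentSpace (𝓡 n) z := liftField p fun _ => v
  let Aξ : Π z : M, TangentSpace (𝓡 n) z := fun z => A z (ξ z)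
  let Bξ : Π z : M, TangentSpace (𝓡 n) z := fun z => B z (ξ z)
  have hAe : Aξ =ᶠ[𝓝 x] liftField p (fun y => A' y v) := by
    filter_upwards [hnhds] with z hz
    rw [hA']; exact apply_liftField A hz _
  have hBe : Bξ =ᶠ[𝓝 x] liftField p (fun y => B' y v) := by
    filter_upwards [hnhds] with z hz
    rw [hB']; exact apply_liftField B hz _
  have hξ : ξ =ᶠ[𝓝 x] liftField p (fun _ => v) := Filter.EventuallyEq.rfl
  have key : B x (mlieBracket (𝓡 n) Aξ ξ x) + A x (mlieBracket (𝓡 n) ξ Bξ x)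
      - mlieBracket (𝓡 n) Aξ Bξ x - A x (B x (mlieBracket (𝓡 n) ξ ξ x)) = 0 :=
    h.2 φ.source ξ φ.open_source (smoothVectorFieldOn_liftField p contDiff_const) x hx
  -- Brackets depend only on germs, so the fields may be replaced by lifts of chart fields. For
  -- constant `v`, `[A'v, v] = -(D_v A')v`, and the other brackets likewise reduce to derivatives of
  -- `A'` and `B'`.
  rw [hAe.mlieBracket_vectorField_eq hξ, hξ.mlieBracket_vectorField_eq hBe,
    hAe.mlieBracket_vectorField_eq hBe, mlieBracket_self] at key
  have key' := congrArg (chartDeriv p x) key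
  simp only [map_add, map_sub, map_zero, Pi.zero_apply, sub_zero, hA x hx, hB x hx,
    chartDeriv_mlieBracket_liftField hx hdAv hdc, chartDeriv_mlieBracket_liftField hx hdc hdBv,
    chartDeriv_mlieBracket_liftField hx hdAv hdBv, lieBracket] at key'
  simp only [← hφ, hfd hdA, hfd hdB, fderiv_fun_const, Pi.zero_apply, zero_apply, map_zero,
    zero_sub, sub_zero] at key'
  rw [← key']
  abel

theorem chartDeriv_self (p : M) (v : TangentSpace (𝓡 n) p) : chartDeriv p p v = v := by
  rw [chartDeriv_eq_mfderiv (mem_chart_source _ p), mfderiv_extChartAt_self]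
  rfl

/-- Lets the independence and eigenvalue hypotheses at `p` pass to the chart unchanged. -/
theorem inChart_self (A : OperatorField n M) (p : M) : A.inChart p p = A p := by
  ext1 v
  exact (congrArg (A.inChart p p) (chartDeriv_self p v)).symm.trans
    ((inChart_chartDeriv A (mem_chart_source _ p) v).trans (chartDeriv_self p _))

end OperatorField

end

/-! ### Riemann invariants on the manifold. -/

open OperatorField in
theorem theorem1 (n : ℕ) {M : Type*} [TopologicalSpace M]
    [ChartedSpace (EuclideanSpace ℝ (Fin n)) M] [IsManifold (𝓡 n) ∞ M]
    (K : Fin n → OperatorField n M)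
    (hsymm : ∀ i j, OperatorField.IsSymmetry (K i) (K j))
    (p : M)
    (hind : LinearIndependent ℝ (fun i => K i p))
    (heig : ∃ c : Fin n → ℝ, ∃ μ : Fin n → ℝ, Function.Injective μ ∧
      ∀ j, Module.End.HasEigenvalue
        ((∑ i, c i • K i p : TangentSpace (𝓡 n) p →L[ℝ] TangentSpace (𝓡 n) p) :
          TangentSpace (𝓡 n) p →ₗ[ℝ] TangentSpace (𝓡 n) p) (μ j)) :
    ∃ φ ∈ IsManifold.maximalAtlas (𝓡 n) ∞ M, p ∈ φ.source ∧
      ∀ x ∈ φ.source, ∀ i, (OperatorField.coordMatrix (K i) φ x).IsDiag := by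
  obtain ⟨c, μ, hμ, heig⟩ := heig
  set ψ := chartAt (EuclideanSpace ℝ (Fin n)) p with hψ
  have hp : p ∈ ψ.source := mem_chart_source _ p
  have hK0 : ∀ i, (K i).inChart p (ψ.symm (ψ p)) = K i p := fun i => by
    rw [ψ.left_inv hp]; exact (K i).inChart_self p
  obtain ⟨Φ, hpΦ, hsub, hΦ, hΦs, hdiag⟩ := exists_diagonalizing_coordinates
    (A := fun i y => (K i).inChart p (ψ.symm y)) ψ.open_target
    (fun i => (K i).contDiffOn_inChart_symm p)
    (fun y hy i j v => (hsymm i j).inChart_comm (ψ.map_target hy) v)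
    (fun y hy i j v => (hsymm i j).fderiv_inChart p rfl rfl hy v)
    (ψ.map_source hp) (by simp only [hK0]; exact hind) (c := c) hμ
    (by simp only [hK0]; exact heig)
  have hmem : ∀ x, x ∈ (ψ.trans Φ).source ↔ x ∈ ψ.source ∧ ψ x ∈ Φ.source := fun x => by
    rw [OpenPartialHomeomorph.trans_source]; rfl
  refine ⟨ψ.trans Φ, ?_, (hmem p).2 ⟨hp, hpΦ⟩, fun x hx i a b hab => ?_⟩
  · apply OpenPartialHomeomorph.mem_maximalAtlas_of_contMDiffOn
    · exact (contMDiffOn_iff_contDiffOn.2 hΦ).comp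
        ((contMDiffOn_chart (I := 𝓡 n) (x := p)).mono fun x hx => ((hmem x).1 hx).1)
        fun x hx => ((hmem x).1 hx).2
    · rw [OpenPartialHomeomorph.trans_target]
      exact (contMDiffOn_chart_symm (I := 𝓡 n) (x := p)).comp
        ((contMDiffOn_iff_contDiffOn.2 hΦs).mono fun y hy => hy.1) fun y hy => hy.2
  · obtain ⟨hxψ, hxΦ⟩ := (hmem x).1 hx
    obtain ⟨hinv, hd⟩ := hdiag _ hxΦ
    obtain ⟨r, hr⟩ := hd i a
    have hderiv : mfderiv (𝓡 n) (𝓡 n) (ψ.trans Φ) x =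
        (fderiv ℝ Φ (ψ x)).comp (chartDeriv p x) := by
      have h1 : HasMFDerivAt (𝓡 n) (𝓡 n) (extChartAt (𝓡 n) p) x (chartDeriv p x) := by
        rw [chartDeriv_eq_mfderiv hxψ]
        exact (mdifferentiableAt_extChartAt hxψ).hasMFDerivAt
      have h2 : HasMFDerivAt (𝓡 n) (𝓡 n) Φ (extChartAt (𝓡 n) p x) (fderiv ℝ Φ (ψ x)) :=
        (((hΦ.contDiffAt (Φ.open_source.mem_nhds hxΦ)).differentiableAt
          (by simp)).hasFDerivAt).hasMFDerivAt
      exact (h2.comp x h1).mfderiv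
    have hDinv : ((fderiv ℝ Φ (ψ x)).comp (chartDeriv p x)).IsInvertible :=
      hinv.comp (isInvertible_chartDeriv hxψ)
    have hcoord : fderiv ℝ Φ (ψ x) (chartDeriv p x (coordVector (ψ.trans Φ) b x)) =
        EuclideanSpace.single b (1 : ℝ) := by
      unfold coordVector
      rw [hderiv]
      exact hDinv.self_apply_inverse _
    have hentry : coordMatrix (K i) (ψ.trans Φ) x a b =
        fderiv ℝ Φ (ψ x) (chartDeriv p x (K i x (coordVector (ψ.trans Φ) b x))) a := by
      simp only [coordMatrix, Matrix.of_apply, hderiv]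
      rfl
    -- In the new coordinates the coordinate vector is the standard basis vector `b`, so entry `(a,
    -- b)` is `r` times its `a`-th component, which is `0` for `a ≠ b`.
    have h3 := hr (chartDeriv p x (coordVector (ψ.trans Φ) b x))
    rw [ψ.left_inv hxψ, inChart_chartDeriv (K i) hxψ, hcoord] at h3
    rw [hentry, h3]
    simp [hab]
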